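/- **Proposition 2.10 (generalized Gauss lemma).** Let $n\ge 2$ and let $D\subseteq\mathbb R^n$ be a domain (nonempty, open, connected). For points of $D$ let $d(x,y)$ be the infimum of the Euclidean lengths of smooth paths in $D$ from $x$ to $y$; for $x,y\in\overline D$ let $d(x,y)=\liminf d(x',y')$ as $x'\to x$, $y'\to y$ in $D$ (under the interior cone condition below this is the extension of $d$ by continuity). A unit-speed intrinsic geodesic from $x$ to $y$ is a path $\Gamma:[0,d(x,y)]\to\overline D$ from $x$ to $y$, parametrized by Euclidean arc length. Suppose that * $D$ is bounded, and it is $\mathrm{CAT}(0)$: for all $a,b,c\in D$, all unit-speed intrinsic geodesics $\Gamma_{ab},\Gamma_{ac},\Gamma_{bc}$, every triangle $\tilde a\tilde b\tilde c$ in the Euclidean plane with side lengths $d(a,b),d(a,c),d(b,c)$, and all $s\in[0,d(a,b)]$, $t\in[0,d(a,c)]$, the distance $d(\Gamma_{ab}(s),\Gamma_{ac}(t))$ is at most the Euclidean distance between the points at distance $s$, respectively $t$, from $\tilde a$ along the sides $\tilde a\tilde b$, respectively $\tilde a\tilde c$; * $D$ satisfies a uniform exterior sphere condition based on a radius $r>0$: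 for every $x\in\partial D$ the set $\mathcal N_{x,r}=\{\nu\in\mathbb R^n: |\nu|=1,\ B(x+r\nu,r)\cap D=\emptyset\}$ is nonempty, and $\mathcal N_{x,r}=\mathcal N_{x,s}$ for $0<s\le r$; * $D$ satisfies a uniform interior cone condition based on a radius $\delta>0$ and an angle $\alpha\in(0,\pi/2]$: for every $x\in\partial D$ there is a unit vector $\mathbf m$ such that, with $C(\mathbf m)=\{z:\langle z,\mathbf m\rangle>|z|\cos\alpha\}$, one has $(y+C(\mathbf m))\cap B(x,\delta)\subseteq D$ for all $y\in D\cap B(x,\delta)$. Then for all $x\ne y$ in $\overline D$ there is a unit-speed intrinsic geodesic from $x$ to $y$, and all of them have the same initial velocity $\chi(x,y)$, a unit vector. Moreover: 1. For every $c_1>0$ there exist $c_2\in(0,\infty)$ and $c_3<\infty$ such that for all $x,y,u\in\overline D$ with $d(x,y)\ge c_1$ and $\max(\sqrt{|u-x|},|u-x|)\le c_2$, $$\bigl|d(u,y)-\bigl(d(x,y)+|u-x|\cos\theta\bigr)\bigr|\le c_3|u-x|^{3/2},$$ where $\theta$ is the angle between $-\chi(x,y)$ (the direction at $x$ of the geodesic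 arriving from $y$) and $u-x$. 2. For all $x\neq y$ in $\overline D$, $\nabla_x d(x,y)=-\chi(x,y)$; that is, $d(u,y)=d(x,y)-\langle\chi(x,y),u-x\rangle+o(|u-x|)$ as $u\to x$ in $\overline D$. 3. For all $x\neq y$ in $\overline D$, $d$ is differentiable at $(x,y)$ as a function on $\overline D\times\overline D$, with $\nabla d(x,y)=(-\chi(x,y),-\chi(y,x))$; that is, $d(u,v)=d(x,y)-\langle\chi(x,y),u-x\rangle-\langle\chi(y,x),v-y\rangle+o(|u-x|+|v-y|)$ as $(u,v)\to(x,y)$ in $\overline D\times\overline D$. -/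

import Mathlib

open Set Filter Topology
open scoped ContDiff

noncomputable section

/-- `γ`, restricted to `[0, 1]`, is a smooth path in `D` from `x` to `y`. -/
structure IsSmoothPathIn {n : ℕ} (D : Set (EuclideanSpace ℝ (Fin n)))
    (x y : EuclideanSpace ℝ (Fin n)) (γ : ℝ → EuclideanSpace ℝ (Fin n)) : Prop where
  smooth : ContDiffOn ℝ ∞ γ (Icc 0 1)
  mapsTo : MapsTo γ (Icc 0 1) D
  source : γ 0 = x
  target : γ 1 = y

/-- The intrinsic distance between two points of `D`: the infimum of the Euclidean lengths of the
smooth paths in `D` connecting them (`⊤` if there is none). -/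
def pathEDist {n : ℕ} (D : Set (EuclideanSpace ℝ (Fin n)))
    (x y : EuclideanSpace ℝ (Fin n)) : ENNReal :=
  ⨅ (γ : ℝ → EuclideanSpace ℝ (Fin n)) (_ : IsSmoothPathIn D x y γ), eVariationOn γ (Icc 0 1)

/-- The extension of the intrinsic distance of `D` to the closure of `D`, as the lower limit of
`pathEDist D x' y'` when `x' → x` and `y' → y` in `D`. For an open set `D` and points of `D` this
is `pathEDist D` again, since that function is continuous on `D × D`. Under a uniform interior cone
condition the lower limit is a limit, so that this is the extension by continuity, which
identifies the Euclidean closure of `D` with the completion of `D` in the intrinsic metric. -/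
def intrinsicEDist {n : ℕ} (D : Set (EuclideanSpace ℝ (Fin n)))
    (x y : EuclideanSpace ℝ (Fin n)) : ENNReal :=
  liminf (fun p : EuclideanSpace ℝ (Fin n) × EuclideanSpace ℝ (Fin n) => pathEDist D p.1 p.2)
    ((𝓝[D] x) ×ˢ (𝓝[D] y))

/-- The intrinsic distance as a real number. -/
def intrinsicDist {n : ℕ} (D : Set (EuclideanSpace ℝ (Fin n)))
    (x y : EuclideanSpace ℝ (Fin n)) : ℝ :=
  (intrinsicEDist D x y).toReal

/-- `Γ`, restricted to `[0, d(x, y)]`, is a unit-speed intrinsic geodesic of `D` from `x` to `y`: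
a path in the closure of `D`, parametrized by its Euclidean arc length, whose length is the
intrinsic distance `d(x, y)`. -/
structure IsIntrinsicGeodesic {n : ℕ} (D : Set (EuclideanSpace ℝ (Fin n)))
    (x y : EuclideanSpace ℝ (Fin n)) (Γ : ℝ → EuclideanSpace ℝ (Fin n)) : Prop where
  mapsTo : MapsTo Γ (Icc 0 (intrinsicDist D x y)) (closure D)
  source : Γ 0 = x
  target : Γ (intrinsicDist D x y) = y
  unitSpeed : HasUnitSpeedOn Γ (Icc 0 (intrinsicDist D x y))

/-- A `CAT(0)` domain: a nonempty connected open set in which geodesic triangles are at most as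
thick as the Euclidean triangles `a' b' c'` with the same side lengths. The point at distance `s`
from `a'` along the side `a' b'` is `AffineMap.lineMap a' b' (s / dist a' b')`, which is `a'` if
the side is degenerate. -/
structure IsCAT0Domain {n : ℕ} (D : Set (EuclideanSpace ℝ (Fin n))) : Prop where
  isOpen : IsOpen D
  isConnected : IsConnected D
  comparison : ∀ a ∈ D, ∀ b ∈ D, ∀ c ∈ D,
    ∀ Γab Γac Γbc : ℝ → EuclideanSpace ℝ (Fin n),
      IsIntrinsicGeodesic D a b Γab → IsIntrinsicGeodesic D a c Γac →
      IsIntrinsicGeodesic D b c Γbc →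
    ∀ a' b' c' : EuclideanSpace ℝ (Fin 2),
      dist a' b' = intrinsicDist D a b → dist a' c' = intrinsicDist D a c →
      dist b' c' = intrinsicDist D b c →
    ∀ s ∈ Icc 0 (intrinsicDist D a b), ∀ t ∈ Icc 0 (intrinsicDist D a c),
      intrinsicEDist D (Γab s) (Γac t) ≤
        edist (AffineMap.lineMap a' b' (s / dist a' b') : EuclideanSpace ℝ (Fin 2))
          (AffineMap.lineMap a' c' (t / dist a' c'))

/-- The set of exterior unit normals at `x` that support an exterior ball of radius `r`. -/
def exteriorNormals {n : ℕ} (D : Set (EuclideanSpace ℝ (Fin n)))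
    (x : EuclideanSpace ℝ (Fin n)) (r : ℝ) : Set (EuclideanSpace ℝ (Fin n)) :=
  {ν | ‖ν‖ = 1 ∧ Metric.ball (x + r • ν) r ∩ D = ∅}

/-- Uniform exterior sphere condition based on radius `r`. -/
def UniformExteriorSphere {n : ℕ} (D : Set (EuclideanSpace ℝ (Fin n))) (r : ℝ) : Prop :=
  ∀ x ∈ frontier D, (exteriorNormals D x r).Nonempty ∧
    ∀ s, 0 < s → s ≤ r → exteriorNormals D x r = exteriorNormals D x s

/-- Uniform interior cone condition based on radius `δ` and angle `α`; the cone based on `y` with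
axis `m` consists of the points `z` with `⟪z - y, m⟫ > ‖z - y‖ cos α`. -/
def UniformInteriorCone {n : ℕ} (D : Set (EuclideanSpace ℝ (Fin n))) (δ α : ℝ) : Prop :=
  ∀ x ∈ frontier D, ∃ m : EuclideanSpace ℝ (Fin n), ‖m‖ = 1 ∧
    ∀ y ∈ D ∩ Metric.ball x δ,
      {z | ‖z - y‖ * Real.cos α < inner ℝ (z - y) m} ∩ Metric.ball x δ ⊆ D

open Classical in
/-- `χ(x, y)`: the initial velocity at `x` of a unit-speed intrinsic geodesic from `x` to `y`
(the right derivative at `0`; the value is `0` if there is no geodesic). -/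
def geodesicDirection {n : ℕ} (D : Set (EuclideanSpace ℝ (Fin n)))
    (x y : EuclideanSpace ℝ (Fin n)) : EuclideanSpace ℝ (Fin n) :=
  if h : ∃ Γ, IsIntrinsicGeodesic D x y Γ then
    derivWithin h.choose (Icc 0 (intrinsicDist D x y)) 0
  else 0

end

/-! The closure `K` of `D`, with the intrinsic distance `d`, is compared with the Euclidean metric.

The exterior sphere condition says that `D` has positive reach: the nearest point of `K` to the
midpoint of a chord of length `h` is at distance `O(h ^ 2)` from it
(`UniformExteriorSphere.exists_near_midpoint`), so that repeated bisection joins the end points of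
the chord inside `K` by fine polygons of length at most `h + O(h ^ 3)`. A small translation along
the axis of the interior cone moves such a polygon into `D`. Hence
`‖x - y‖ ≤ d x y ≤ ‖x - y‖ + C ‖x - y‖ ^ 3` at small scales (`IsNearEuclideanMetric`), first on `D`
and then, by continuity, on `K`.

Three consequences of this cubic comparison carry the argument. The Euclidean length of a path in
`K` equals its `d`-length, so the unit-speed intrinsic geodesics are the isometric embeddings of
intervals in `(K, d)`; by compactness they exist. The slopes of a geodesic `Γ` at two
times at most `t` differ by `O(t)`, so that `Γ` has an initial velocity `χ` with
`Γ t = x + t χ + O(t ^ 2)`, uniformly (`IsNearEuclideanMetric.exists_velocity`). And the `CAT(0)`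
comparison, which is assumed for vertices in `D` only, extends to `K` in the form of the inequality
of Bruhat and Tits, which gives uniqueness of geodesics and convexity of `d`
(`IsCAT0Domain.isBruhatTitsMetric`, `IsBruhatTitsMetric.dist_le`).

For the first variation, put `σ = √‖u - x‖`. Going from `u` straight to `Γ σ` and then along `Γ`
gives `d u y ≤ d x y - ⟪χ x y, u - x⟫ + O(σ ^ 3)`. By convexity the geodesics from `x` and from `u`
to `y` are at distance `O(σ ^ 2)` at time `σ`, so `χ u y - χ x y = O(σ)`, and interchanging `u` and
`x` in the upper bound yields the lower one. The gradients follow, the one in both variables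
because `χ x v` depends continuously on `v`. -/

/-! ### The intrinsic distance between points of the domain -/

theorem LipschitzOnWith.eVariationOn_Icc_le {E : Type*} [PseudoEMetricSpace E] {γ : ℝ → E}
    {κ : NNReal} {s t : ℝ} (h : LipschitzOnWith κ γ (Icc s t)) :
    eVariationOn γ (Icc s t) ≤ κ * ENNReal.ofReal (t - s) := by
  have hid := (monotone_id (α := ℝ)).monotoneOn univ |>.eVariationOn_eq (mem_univ s) (mem_univ t)
  simp only [univ_inter, id] at hid
  have hv := h.comp_eVariationOn_le (g := id) (s := Icc s t) (mapsTo_id _)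
  exact hv.trans_eq (congrArg _ hid)

section PathDistance

variable {n : ℕ} {D : Set (EuclideanSpace ℝ (Fin n))} {x y z : EuclideanSpace ℝ (Fin n)}

theorem IsSmoothPathIn.pathEDist_le {γ : ℝ → EuclideanSpace ℝ (Fin n)}
    (h : IsSmoothPathIn D x y γ) : pathEDist D x y ≤ eVariationOn γ (Icc 0 1) :=
  iInf₂_le γ h

theorem edist_le_pathEDist : edist x y ≤ pathEDist D x y := by
  refine le_iInf₂ fun γ h => ?_
  have := eVariationOn.edist_le γ (s := Icc (0 : ℝ) 1) (x := 0) (y := 1) (by simp) (by simp)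
  rwa [h.source, h.target] at this

theorem pathEDist_le_comm : pathEDist D x y ≤ pathEDist D y x := by
  refine le_iInf₂ fun γ h => ?_
  have hm : MapsTo (fun t : ℝ => 1 - t) (Icc 0 1) (Icc 0 1) := fun t ht => by
    constructor <;> linarith [ht.1, ht.2]
  have hp : IsSmoothPathIn D x y (γ ∘ fun t => 1 - t) := by
    refine ⟨h.smooth.comp (by fun_prop) hm, h.mapsTo.comp hm, ?_, ?_⟩
    · simpa using h.target
    · simpa using h.source
  refine hp.pathEDist_le.trans (eVariationOn.comp_le_of_antitoneOn _ _ ?_ hm)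
  exact fun a _ b _ hab => sub_le_sub_left hab 1

theorem pathEDist_comm : pathEDist D x y = pathEDist D y x :=
  le_antisymm pathEDist_le_comm pathEDist_le_comm

/-- Two smooth paths `γ₁`, `γ₂` are concatenated by `t ↦ γ₁ (σ (2 t)) + γ₂ (σ (2 t - 1)) - y`, where
`σ` is the smooth transition from `0` to `1`: at each time one of the first two terms is `y`. -/
theorem pathEDist_triangle : pathEDist D x z ≤ pathEDist D x y + pathEDist D y z := by
  refine ENNReal.le_iInf₂_add_iInf₂ fun γ₁ h₁ γ₂ h₂ => ?_
  set a : ℝ → ℝ := fun t => Real.smoothTransition (2 * t) with ha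
  set b : ℝ → ℝ := fun t => Real.smoothTransition (2 * t - 1) with hb
  have hsm : ContDiff ℝ ∞ Real.smoothTransition := Real.smoothTransition.contDiff
  have haI : ∀ t, a t ∈ Icc (0 : ℝ) 1 := fun t =>
    ⟨Real.smoothTransition.nonneg _, Real.smoothTransition.le_one _⟩
  have hbI : ∀ t, b t ∈ Icc (0 : ℝ) 1 := fun t =>
    ⟨Real.smoothTransition.nonneg _, Real.smoothTransition.le_one _⟩
  have hac : ContDiff ℝ ∞ a := hsm.comp (by fun_prop)
  have hbc : ContDiff ℝ ∞ b := hsm.comp (by fun_prop)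
  have ham : Monotone a := fun s t h => Real.smoothTransition.monotone (by linarith)
  have hbm : Monotone b := fun s t h => Real.smoothTransition.monotone (by linarith)
  set γ : ℝ → EuclideanSpace ℝ (Fin n) := fun t => γ₁ (a t) + γ₂ (b t) - y with hγ
  have hl : EqOn γ (γ₁ ∘ a) (Icc 0 (1 / 2)) := fun t ht => by
    have : b t = 0 := Real.smoothTransition.zero_of_nonpos (by linarith [ht.2])
    simp [hγ, this, h₂.source]
  have hr : EqOn γ (γ₂ ∘ b) (Icc (1 / 2) 1) := fun t ht => by
    have : a t = 1 := Real.smoothTransition.one_of_one_le (by linarith [ht.1])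
    simp [hγ, this, h₁.target]
  have hp : IsSmoothPathIn D x z γ := by
    refine ⟨?_, ?_, ?_, ?_⟩
    · exact ((h₁.smooth.comp hac.contDiffOn fun t _ => haI t).add
        (h₂.smooth.comp hbc.contDiffOn fun t _ => hbI t)).sub contDiffOn_const
    · intro t ht
      rcases le_total t (1 / 2) with h | h
      · rw [hl ⟨ht.1, h⟩]
        exact h₁.mapsTo (haI t)
      · rw [hr ⟨h, ht.2⟩]
        exact h₂.mapsTo (hbI t)
    · rw [hl ⟨le_rfl, by norm_num⟩]
      simp [ha, h₁.source, Real.smoothTransition.zero_of_nonpos]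
    · rw [hr ⟨by norm_num, le_rfl⟩]
      have : b 1 = 1 := Real.smoothTransition.one_of_one_le (by norm_num)
      simp [this, h₂.target]
  refine hp.pathEDist_le.trans ?_
  have hsplit := eVariationOn.Icc_add_Icc γ (s := univ) (a := 0) (b := 1 / 2) (c := 1)
    (by norm_num) (by norm_num) (mem_univ _)
  simp only [univ_inter] at hsplit
  rw [← hsplit, eVariationOn.congr hl, eVariationOn.congr hr]
  exact add_le_add
    (eVariationOn.comp_le_of_monotoneOn _ _ (ham.monotoneOn _) fun t _ => haI t)
    (eVariationOn.comp_le_of_monotoneOn _ _ (hbm.monotoneOn _) fun t _ => hbI t)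

/-- A part of a smooth path in `D` bounds the intrinsic distance of its end points. -/
theorem IsSmoothPathIn.pathEDist_le_subpath {γ : ℝ → EuclideanSpace ℝ (Fin n)}
    (h : IsSmoothPathIn D x y γ) {s t : ℝ} (hs : 0 ≤ s) (hst : s ≤ t) (ht : t ≤ 1) :
    pathEDist D (γ s) (γ t) ≤ eVariationOn γ (Icc s t) := by
  set φ : ℝ → ℝ := fun u => s + u * (t - s) with hφ
  have hm : MapsTo φ (Icc 0 1) (Icc s t) := fun u hu => by
    constructor <;> simp only [hφ] <;> nlinarith [hu.1, hu.2]
  have hI : Icc s t ⊆ Icc 0 1 := Icc_subset_Icc hs ht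
  have hp : IsSmoothPathIn D (γ s) (γ t) (γ ∘ φ) := by
    refine ⟨h.smooth.comp (by fun_prop) (hm.mono_right hI), h.mapsTo.comp (hm.mono_right hI),
      ?_, ?_⟩
    · simp [hφ]
    · simp [hφ]
  refine hp.pathEDist_le.trans (eVariationOn.comp_le_of_monotoneOn _ _ ?_ hm)
  intro a _ b _ hab
  simp only [hφ]
  nlinarith

theorem pathEDist_le_of_segment (h : segment ℝ x y ⊆ D) : pathEDist D x y ≤ edist x y := by
  have hp : IsSmoothPathIn D x y (AffineMap.lineMap x y : ℝ →ᵃ[ℝ] EuclideanSpace ℝ (Fin n)) := by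
    refine ⟨?_, ?_, by simp, by simp⟩
    · have : (⇑(AffineMap.lineMap x y : ℝ →ᵃ[ℝ] EuclideanSpace ℝ (Fin n)))
          = fun t : ℝ => t • (y - x) + x := by
        ext t; simp [AffineMap.lineMap_apply]
      rw [this]
      fun_prop
    · rw [segment_eq_image_lineMap] at h
      exact fun t ht => h (mem_image_of_mem _ ht)
  refine hp.pathEDist_le.trans ?_
  have hv := ((lipschitzWith_lineMap (𝕜 := ℝ) x y).lipschitzOnWith
    (s := Icc (0 : ℝ) 1)).eVariationOn_Icc_le
  rw [sub_zero, ENNReal.ofReal_one, mul_one] at hv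
  exact hv.trans_eq (edist_nndist x y).symm

theorem pathEDist_ne_top (hD : IsOpen D) (hc : IsConnected D) (hx : x ∈ D) (hy : y ∈ D) :
    pathEDist D x y ≠ ⊤ := by
  refine hc.isPreconnected.induction₂ (fun x y => pathEDist D x y ≠ ⊤) ?_ ?_ ?_ hx hy
  · intro x hx
    obtain ⟨ε, hε, hb⟩ := Metric.isOpen_iff.1 hD x hx
    refine mem_nhdsWithin_of_mem_nhds (mem_of_superset (Metric.ball_mem_nhds x hε) fun y hy => ?_)
    exact ((pathEDist_le_of_segment (((convex_ball x ε).segment_subset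
      (Metric.mem_ball_self hε) hy).trans hb)).trans_lt (edist_lt_top x y)).ne
  · intro x y z _ _ _ h₁ h₂
    exact (pathEDist_triangle.trans_lt (ENNReal.add_lt_top.2 ⟨h₁.lt_top, h₂.lt_top⟩)).ne
  · intro x y _ _ h
    rwa [pathEDist_comm]

end PathDistance

/-! ### Positive reach and the local comparison with the Euclidean distance -/

section Reach

variable {n : ℕ} {D : Set (EuclideanSpace ℝ (Fin n))} {r : ℝ}

/-- A point outside `D` and its nearest point on the closure of `D`: the exterior sphere condition
enlarges the ball centred at the outer point to one of radius `r`, which gives Federer's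
inequality for sets of reach `r`. -/
theorem UniformExteriorSphere.inner_le (hD : IsOpen D) (hr : 0 < r)
    (hs : UniformExteriorSphere D r) {m p z : EuclideanSpace ℝ (Fin n)} (hp : p ∈ closure D)
    (hmin : ∀ q ∈ closure D, ‖m - p‖ ≤ ‖m - q‖) (hmr : ‖m - p‖ ≤ r) (hz : z ∈ closure D) :
    2 * r * inner ℝ (m - p) (z - p) ≤ ‖m - p‖ * ‖z - p‖ ^ 2 := by
  rcases eq_or_ne m p with rfl | hne
  · simp
  set ρ := ‖m - p‖ with hρ
  have hρ0 : 0 < ρ := norm_pos_iff.2 (sub_ne_zero.2 hne)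
  have hpD : p ∉ D := by
    intro hpD
    have hc : Tendsto (fun t : ℝ => p + t • (m - p)) (𝓝[>] 0) (𝓝 p) := by
      have : Continuous fun t : ℝ => p + t • (m - p) := by fun_prop
      simpa using (this.tendsto 0).mono_left nhdsWithin_le_nhds
    obtain ⟨t, ht, ht0, ht1⟩ := ((hc.eventually (hD.mem_nhds hpD)).and
      (Ioo_mem_nhdsGT (zero_lt_one (α := ℝ)))).exists
    have h := hmin _ (subset_closure ht)
    have e : m - (p + t • (m - p)) = (1 - t) • (m - p) := by module
    rw [e, norm_smul, Real.norm_eq_abs, abs_of_pos (by linarith), ← hρ] at h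
    nlinarith
  have hfr : p ∈ frontier D := ⟨hp, by rwa [hD.interior_eq]⟩
  obtain ⟨-, hall⟩ := hs p hfr
  set ν := ρ⁻¹ • (m - p) with hν
  have hmν : m - p = ρ • ν := by rw [hν, smul_smul, mul_inv_cancel₀ hρ0.ne', one_smul]
  have hν1 : ‖ν‖ = 1 := by
    rw [hν, norm_smul, norm_inv, Real.norm_of_nonneg hρ0.le, ← hρ, inv_mul_cancel₀ hρ0.ne']
  have hνρ : ν ∈ exteriorNormals D p ρ := by
    refine ⟨hν1, eq_empty_iff_forall_notMem.2 ?_⟩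
    rintro q ⟨hq, hqD⟩
    rw [← hmν, add_sub_cancel, Metric.mem_ball, dist_comm, dist_eq_norm] at hq
    exact absurd (hmin q (subset_closure hqD)) (not_le.2 hq)
  rw [← hall ρ hρ0 hmr] at hνρ
  have hdisj : Disjoint (Metric.ball (p + r • ν) r) (closure D) :=
    (disjoint_iff_inter_eq_empty.2 hνρ.2).closure_right Metric.isOpen_ball
  have hzb : r ≤ ‖z - p - r • ν‖ := by
    by_contra! h
    refine Set.disjoint_left.1 hdisj ?_ hz
    rwa [Metric.mem_ball, dist_eq_norm, ← sub_sub]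
  have hsq : r ^ 2 ≤ ‖z - p - r • ν‖ ^ 2 := by gcongr
  rw [norm_sub_sq_real, norm_smul, hν1, inner_smul_right, Real.norm_of_nonneg hr.le] at hsq
  rw [hmν, inner_smul_left, real_inner_comm]
  simp only [conj_trivial]
  nlinarith

/-- The midpoint of two points of the closure is at distance `O(h ^ 2)` from the closure; the
nearest point splits the chord into two parts of almost the same total length. -/
theorem UniformExteriorSphere.exists_near_midpoint (hD : IsOpen D) (hr : 0 < r)
    (hs : UniformExteriorSphere D r) {x y : EuclideanSpace ℝ (Fin n)} (hx : x ∈ closure D)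
    (hy : y ∈ closure D) (hxy : ‖x - y‖ ≤ 2 * r / 3) :
    ∃ p ∈ closure D, ‖x - p‖ ≤ 2 / 3 * ‖x - y‖ ∧ ‖p - y‖ ≤ 2 / 3 * ‖x - y‖ ∧
      ‖x - p‖ + ‖p - y‖ ≤ ‖x - y‖ + ‖x - y‖ ^ 3 / (8 * r ^ 2) := by
  set h := ‖x - y‖ with hh
  have hh0 : 0 ≤ h := norm_nonneg _
  set m := (1 / 2 : ℝ) • (x + y) with hm
  obtain ⟨p, hp, hpm⟩ := isClosed_closure.exists_infDist_eq_dist ⟨x, hx⟩ m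
  have hmin : ∀ q ∈ closure D, ‖m - p‖ ≤ ‖m - q‖ := fun q hq => by
    rw [← dist_eq_norm, ← dist_eq_norm, ← hpm]
    exact Metric.infDist_le_dist_of_mem hq
  set w := m - p with hw
  set v := (1 / 2 : ℝ) • (x - y) with hv
  have hvn : ‖v‖ = h / 2 := by rw [hv, norm_smul]; norm_num; rw [← hh]; ring
  have hxp : x - p = w + v := by rw [hw, hv, hm]; module
  have hyp : y - p = w - v := by rw [hw, hv, hm]; module
  have hρ : ‖w‖ ≤ h / 2 := by
    have := hmin x hx
    have e : m - x = -v := by rw [hv, hm]; module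
    rwa [e, norm_neg, hvn] at this
  have h1 := hs.inner_le hD hr hp hmin (by linarith) hx
  have h2 := hs.inner_le hD hr hp hmin (by linarith) hy
  rw [← hw, hxp, norm_add_sq_real, inner_add_right, real_inner_self_eq_norm_sq, hvn] at h1
  rw [← hw, hyp, norm_sub_sq_real, inner_sub_right, real_inner_self_eq_norm_sq, hvn] at h2
  set ρ := ‖w‖ with hρd
  have hρ0 : 0 ≤ ρ := norm_nonneg _
  have hρ2 : ρ ≤ h ^ 2 / (4 * r) := by
    rcases hρ0.eq_or_lt with h0 | h0
    · rw [← h0]; positivity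
    rw [le_div_iff₀ (by positivity)]
    -- summing the two inequalities yields `4 r ρ² ≤ ρ (2 ρ² + h² / 2)`, and `ρ ≤ h / 2`
    have : ρ * (4 * r * ρ) ≤ ρ * (2 * ρ ^ 2 + h ^ 2 / 2) := by nlinarith
    have := le_of_mul_le_mul_left this h0
    nlinarith
  have hρ6 : ρ ≤ h / 6 := by
    refine hρ2.trans ?_
    rw [div_le_div_iff₀ (by positivity) (by norm_num)]
    nlinarith
  have ex : ‖x - p‖ ≤ ρ + h / 2 := by rw [hxp, ← hvn]; exact norm_add_le _ _
  have ey : ‖p - y‖ ≤ ρ + h / 2 := by rw [norm_sub_rev, hyp, ← hvn]; exact norm_sub_le _ _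
  refine ⟨p, hp, by linarith, by linarith, ?_⟩
  have hsum : ‖x - p‖ ^ 2 + ‖p - y‖ ^ 2 = 2 * ρ ^ 2 + h ^ 2 / 2 := by
    rw [norm_sub_rev p y, hxp, hyp, norm_add_sq_real, norm_sub_sq_real w v, hvn]; ring
  refine abs_le_of_sq_le_sq' (b := h + h ^ 3 / (8 * r ^ 2)) ?_ (by positivity) |>.2
  have hk : 4 * ρ ^ 2 ≤ h ^ 4 / (4 * r ^ 2) := by
    have : ρ ^ 2 ≤ (h ^ 2 / (4 * r)) ^ 2 := by gcongr
    refine (mul_le_mul_of_nonneg_left this (by norm_num)).trans_eq ?_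
    field_simp
  have hexp : (h + h ^ 3 / (8 * r ^ 2)) ^ 2 =
      h ^ 2 + h ^ 4 / (4 * r ^ 2) + (h ^ 3 / (8 * r ^ 2)) ^ 2 := by
    field_simp
    ring
  nlinarith [sq_nonneg (‖x - p‖ - ‖p - y‖), sq_nonneg (h ^ 3 / (8 * r ^ 2))]

/-- If `f` satisfies the triangle inequality and is at most the Euclidean distance at small scales
near `x₀`, then it exceeds the Euclidean distance by at most `‖x - y‖ ^ 3 / (4 r ^ 2)`: the chord
is bisected, with midpoints moved into the closure of `D`, until the small scale is reached. -/
theorem UniformExteriorSphere.le_of_small_scale (hD : IsOpen D) (hr : 0 < r)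
    (hs : UniformExteriorSphere D r) {x₀ : EuclideanSpace ℝ (Fin n)} {R η : ℝ} (hη : 0 < η)
    (f : EuclideanSpace ℝ (Fin n) → EuclideanSpace ℝ (Fin n) → ENNReal)
    (htri : ∀ x y z, f x z ≤ f x y + f y z)
    (hsmall : ∀ x ∈ closure D, ∀ y ∈ closure D, ‖x - x₀‖ ≤ R → ‖y - x₀‖ ≤ R → ‖x - y‖ ≤ η →
      f x y ≤ ENNReal.ofReal ‖x - y‖)
    {x y : EuclideanSpace ℝ (Fin n)} (hx : x ∈ closure D) (hy : y ∈ closure D)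
    (hxy : ‖x - y‖ ≤ 2 * r / 3) (hxR : ‖x - x₀‖ + 3 * ‖x - y‖ ≤ R)
    (hyR : ‖y - x₀‖ + 3 * ‖x - y‖ ≤ R) :
    f x y ≤ ENNReal.ofReal (‖x - y‖ + ‖x - y‖ ^ 3 / (4 * r ^ 2)) := by
  obtain ⟨k, hk⟩ : ∃ k : ℕ, ‖x - y‖ * (2 / 3 : ℝ) ^ k ≤ η := by
    have : Tendsto (fun k : ℕ => ‖x - y‖ * (2 / 3 : ℝ) ^ k) atTop (𝓝 (‖x - y‖ * 0)) :=
      (tendsto_pow_atTop_nhds_zero_of_lt_one (by norm_num) (by norm_num)).const_mul _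
    rw [mul_zero] at this
    exact ((this.eventually (gt_mem_nhds hη)).exists).imp fun _ h => h.le
  induction k generalizing x y with
  | zero =>
    have hn := norm_nonneg (x - y)
    refine (hsmall x hx y hy (by linarith) (by linarith) (by simpa using hk)).trans
      (ENNReal.ofReal_le_ofReal ?_)
    have : 0 ≤ ‖x - y‖ ^ 3 / (4 * r ^ 2) := by positivity
    linarith
  | succ k ih =>
    obtain ⟨p, hp, hxp, hpy, hsum⟩ := hs.exists_near_midpoint hD hr hx hy hxy
    have hn := norm_nonneg (x - y)
    have hpx : ‖p - x₀‖ ≤ ‖x - p‖ + ‖x - x₀‖ := by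
      have := norm_sub_le (x - x₀) (x - p)
      rw [sub_sub_sub_cancel_left] at this
      linarith
    have hpow : (0 : ℝ) < (2 / 3) ^ k := by positivity
    have h1 := ih hx hp (by linarith) (by linarith) (by linarith)
      ((mul_le_mul_of_nonneg_right hxp hpow.le).trans (by rw [pow_succ] at hk; linarith))
    have h2 := ih hp hy (by linarith) (by linarith) (by linarith)
      ((mul_le_mul_of_nonneg_right hpy hpow.le).trans (by rw [pow_succ] at hk; linarith))
    refine (htri x p y).trans ((add_le_add h1 h2).trans ?_)
    rw [← ENNReal.ofReal_add (by positivity) (by positivity)]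
    refine ENNReal.ofReal_le_ofReal ?_
    set a := ‖x - p‖
    set b := ‖p - y‖
    set h := ‖x - y‖
    have ha : 0 ≤ a := norm_nonneg _
    have hb : 0 ≤ b := norm_nonneg _
    -- `a³ + b³ ≤ (4/9) h² (a + b) ≤ (4/9) (19/18) h³ ≤ h³ / 2`
    have hab : a + b ≤ 19 / 18 * h := by
      refine hsum.trans ?_
      have : h ^ 3 / (8 * r ^ 2) ≤ h / 18 := by
        rw [div_le_div_iff₀ (by positivity) (by norm_num)]
        have : h ^ 2 ≤ (2 * r / 3) ^ 2 := by gcongr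
        nlinarith
      linarith
    have ha3 : a ^ 3 ≤ 4 / 9 * h ^ 2 * a := by
      have : a ^ 2 ≤ (2 / 3 * h) ^ 2 := by gcongr
      nlinarith
    have hb3 : b ^ 3 ≤ 4 / 9 * h ^ 2 * b := by
      have : b ^ 2 ≤ (2 / 3 * h) ^ 2 := by gcongr
      nlinarith
    have h3 : a ^ 3 + b ^ 3 ≤ h ^ 3 / 2 := by
      have : 4 / 9 * h ^ 2 * (a + b) ≤ 4 / 9 * h ^ 2 * (19 / 18 * h) := by gcongr
      have : 0 ≤ h ^ 3 := by positivity
      nlinarith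
    have h4 : a ^ 3 / (4 * r ^ 2) + b ^ 3 / (4 * r ^ 2) ≤ h ^ 3 / (8 * r ^ 2) := by
      rw [← add_div, div_le_div_iff₀ (by positivity) (by positivity)]
      nlinarith [sq_nonneg r]
    have h5 : h ^ 3 / (4 * r ^ 2) = h ^ 3 / (8 * r ^ 2) + h ^ 3 / (8 * r ^ 2) := by
      field_simp; ring
    linarith

end Reach

section Local

variable {n : ℕ} {D : Set (EuclideanSpace ℝ (Fin n))} {r δ α : ℝ}

/-- The interior cone condition passes to base points in the closure, since the cone is open. -/
theorem UniformInteriorCone.exists_axis (hcone : UniformInteriorCone D δ α)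
    {x₀ : EuclideanSpace ℝ (Fin n)} (hx₀ : x₀ ∈ frontier D) :
    ∃ m : EuclideanSpace ℝ (Fin n), ‖m‖ = 1 ∧ ∀ y ∈ closure D, ‖y - x₀‖ < δ →
      ∀ z, ‖z - x₀‖ < δ → ‖z - y‖ * Real.cos α < inner ℝ (z - y) m → z ∈ D := by
  obtain ⟨m, hm, h⟩ := hcone x₀ hx₀
  refine ⟨m, hm, fun y hy hyδ z hzδ hz => ?_⟩
  have hc1 : ∀ᶠ y' in 𝓝 y, ‖z - y'‖ * Real.cos α < inner ℝ (z - y') m := by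
    have h1 : Continuous fun y' => ‖z - y'‖ * Real.cos α := by fun_prop
    have h2 : Continuous fun y' => inner ℝ (z - y') m := by fun_prop
    exact h1.continuousAt.eventually_lt h2.continuousAt hz
  have hc2 : ∀ᶠ y' in 𝓝 y, ‖y' - x₀‖ < δ := by
    have h1 : Continuous fun y' => ‖y' - x₀‖ := by fun_prop
    exact h1.continuousAt.eventually_lt continuousAt_const hyδ
  obtain ⟨y', hy'D, hy1, hy2⟩ := ((mem_closure_iff_frequently.1 hy).and_eventually
    (hc1.and hc2)).exists
  exact h y' ⟨hy'D, by rwa [Metric.mem_ball, dist_eq_norm]⟩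
    ⟨hy1, by rwa [Metric.mem_ball, dist_eq_norm]⟩

/-- A segment that leaves an open set meets the frontier. -/
theorem exists_mem_frontier_of_segment (hD : IsOpen D) {x y : EuclideanSpace ℝ (Fin n)}
    (hx : x ∈ D) (h : ¬ segment ℝ x y ⊆ D) : ∃ z ∈ segment ℝ x y, z ∈ frontier D := by
  by_contra! hcon
  refine h ((convex_segment x y).isPreconnected.subset_left_of_subset_union hD
    (isClosed_closure (s := D)).isOpen_compl ?_ ?_ ⟨x, left_mem_segment ℝ x y, hx⟩)
  · exact Set.disjoint_left.2 fun z hz hz' => hz' (subset_closure hz)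
  · intro z hz
    by_cases hzD : z ∈ D
    · exact Or.inl hzD
    · exact Or.inr fun hzc => hcon z hz ⟨hzc, by rwa [hD.interior_eq]⟩

/-- At small scales the intrinsic distance exceeds the Euclidean one by at most a cubic term. Near
the frontier, chords that are short compared with `ε` are contained in `D` after a translation by
`ε` along the axis `m` of the cone, so that `UniformExteriorSphere.le_of_small_scale` applies to the
translated distance; then `ε` tends to `0`. -/
theorem pathEDist_le_of_norm_le (hD : IsOpen D) (hr : 0 < r) (hs : UniformExteriorSphere D r)
    (hδ : 0 < δ) (hα : α ∈ Ioc 0 (Real.pi / 2)) (hcone : UniformInteriorCone D δ α)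
    {x y : EuclideanSpace ℝ (Fin n)} (hx : x ∈ D) (hy : y ∈ D) (hxr : ‖x - y‖ ≤ 2 * r / 3)
    (hxδ : ‖x - y‖ ≤ δ / 16) :
    pathEDist D x y ≤ ENNReal.ofReal (‖x - y‖ + ‖x - y‖ ^ 3 / (4 * r ^ 2)) := by
  by_cases hseg : segment ℝ x y ⊆ D
  · refine (pathEDist_le_of_segment hseg).trans ?_
    rw [edist_dist, dist_eq_norm]
    refine ENNReal.ofReal_le_ofReal ?_
    have : 0 ≤ ‖x - y‖ ^ 3 / (4 * r ^ 2) := by positivity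
    linarith
  obtain ⟨x₀, hx₀s, hx₀⟩ := exists_mem_frontier_of_segment hD hx hseg
  have hxx₀ : ‖x - x₀‖ ≤ ‖x - y‖ := by
    rw [← dist_eq_norm, ← dist_eq_norm, dist_comm x x₀]
    have := (convex_closedBall x (dist x y)).segment_subset
      (Metric.mem_closedBall_self dist_nonneg) (by rw [Metric.mem_closedBall, dist_comm]) hx₀s
    exact this
  have hyx₀ : ‖y - x₀‖ ≤ ‖x - y‖ := by
    rw [← dist_eq_norm, ← dist_eq_norm, dist_comm y x₀]
    have := (convex_closedBall y (dist x y)).segment_subset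
      (by rw [Metric.mem_closedBall]) (Metric.mem_closedBall_self dist_nonneg) hx₀s
    exact this
  obtain ⟨m, hm, hax⟩ := hcone.exists_axis hx₀
  have hc0 : 0 ≤ Real.cos α := Real.cos_nonneg_of_mem_Icc ⟨by linarith [hα.1, Real.pi_pos], hα.2⟩
  have hc1 : Real.cos α < 1 := by
    have := Real.cos_lt_cos_of_nonneg_of_le_pi_div_two le_rfl hα.2 hα.1
    rwa [Real.cos_zero] at this
  -- translation by `ε • m` moves the closure into `D`, with a margin
  have hin : ∀ ε, 0 < ε → ε < δ / 4 → ∀ p ∈ closure D, ‖p - x₀‖ ≤ δ / 2 → ∀ w,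
      ‖w‖ ≤ ε * ((1 - Real.cos α) / 4) → p + ε • m + w ∈ D := by
    intro ε hε hεδ p hp hpδ w hw
    have hwε : ‖w‖ < ε := lt_of_le_of_lt hw (by nlinarith)
    have hεm : ‖ε • m‖ = ε := by rw [norm_smul, hm, mul_one, Real.norm_of_nonneg hε.le]
    refine hax p hp (by linarith) _ ?_ ?_
    · have e : p + ε • m + w - x₀ = (p - x₀) + ε • m + w := by abel
      rw [e]
      refine (norm_add₃_le).trans_lt ?_
      rw [hεm]
      linarith
    · have e : p + ε • m + w - p = ε • m + w := by abel
      rw [e, inner_add_left, inner_smul_left, real_inner_self_eq_norm_sq, hm]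
      have h1 : ‖ε • m + w‖ ≤ ε + ‖w‖ := (norm_add_le _ _).trans_eq (by rw [hεm])
      have h2 : -‖w‖ ≤ inner ℝ w m := by
        have := abs_le.1 (abs_real_inner_le_norm w m)
        rw [hm, mul_one] at this
        exact this.1
      simp only [conj_trivial, one_pow, mul_one]
      nlinarith [norm_nonneg w]
  have hmargin : ∀ ε, 0 < ε → 0 < ε * ((1 - Real.cos α) / 4) := fun ε hε =>
    mul_pos hε (by linarith)
  have key : ∀ ε, 0 < ε → ε < δ / 4 → pathEDist D x y ≤
      ENNReal.ofReal (ε + (‖x - y‖ + ‖x - y‖ ^ 3 / (4 * r ^ 2)) + ε) := by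
    intro ε hε hεδ
    have hmid : pathEDist D (x + ε • m) (y + ε • m) ≤
        ENNReal.ofReal (‖x - y‖ + ‖x - y‖ ^ 3 / (4 * r ^ 2)) := by
      refine hs.le_of_small_scale hD hr (x₀ := x₀) (R := δ / 2) (hmargin ε hε)
        (fun x y => pathEDist D (x + ε • m) (y + ε • m)) (fun _ _ _ => pathEDist_triangle) ?_
        (subset_closure hx) (subset_closure hy) hxr (by linarith) (by linarith)
      intro p hp q _ hpR _ hpq
      have hsub : segment ℝ (p + ε • m) (q + ε • m) ⊆ D := by
        rw [segment_eq_image']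
        rintro _ ⟨t, ht, rfl⟩
        have e : p + ε • m + t • (q + ε • m - (p + ε • m)) = p + ε • m + t • (q - p) := by
          rw [add_sub_add_right_eq_sub]
        change p + ε • m + t • (q + ε • m - (p + ε • m)) ∈ D
        rw [e]
        refine hin ε hε hεδ p hp hpR _ ?_
        rw [norm_smul, Real.norm_of_nonneg ht.1, norm_sub_rev]
        exact (mul_le_of_le_one_left (norm_nonneg _) ht.2).trans hpq
      refine (pathEDist_le_of_segment hsub).trans ?_
      rw [edist_add_right, edist_dist, dist_eq_norm]
    have hends : ∀ p ∈ D, ‖p - x₀‖ ≤ δ / 2 → pathEDist D p (p + ε • m) ≤ ENNReal.ofReal ε := by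
      intro p hp hpR
      have hsub : segment ℝ p (p + ε • m) ⊆ D := by
        rw [segment_eq_image']
        rintro _ ⟨t, ht, rfl⟩
        change p + t • (p + ε • m - p) ∈ D
        rw [add_sub_cancel_left, smul_smul]
        rcases ht.1.eq_or_lt with h0 | h0
        · simpa [← h0] using hp
        · have := hin (t * ε) (by positivity) (by nlinarith [ht.2]) p (subset_closure hp) hpR 0
            (by rw [norm_zero]; exact (hmargin _ (by positivity)).le)
          rwa [add_zero] at this
      refine (pathEDist_le_of_segment hsub).trans ?_
      rw [edist_dist, dist_eq_norm, sub_add_cancel_left, norm_neg, norm_smul, hm, mul_one,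
        Real.norm_of_nonneg hε.le]
    have h1 := hends x hx (by linarith)
    have h2 := hends y hy (by linarith)
    rw [pathEDist_comm] at h2
    refine (pathEDist_triangle (y := y + ε • m)).trans
      ((add_le_add (pathEDist_triangle (y := x + ε • m)) le_rfl).trans ?_)
    rw [ENNReal.ofReal_add (by positivity) hε.le, ENNReal.ofReal_add hε.le (by positivity)]
    exact add_le_add (add_le_add h1 hmid) h2
  have hlim : Tendsto (fun ε : ℝ =>
      ENNReal.ofReal (ε + (‖x - y‖ + ‖x - y‖ ^ 3 / (4 * r ^ 2)) + ε)) (𝓝[>] 0)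
      (𝓝 (ENNReal.ofReal (‖x - y‖ + ‖x - y‖ ^ 3 / (4 * r ^ 2)))) := by
    have hc : Continuous fun ε : ℝ =>
      ENNReal.ofReal (ε + (‖x - y‖ + ‖x - y‖ ^ 3 / (4 * r ^ 2)) + ε) :=
        ENNReal.continuous_ofReal.comp (by fun_prop)
    have := (hc.tendsto 0).mono_left (nhdsWithin_le_nhds (s := Ioi 0))
    simpa using this
  refine ge_of_tendsto hlim ?_
  filter_upwards [Ioo_mem_nhdsGT (show (0 : ℝ) < δ / 4 by linarith)] with ε hε
  exact key ε hε.1 hε.2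

end Local

/-! ### The intrinsic distance on the closure -/

/-- A metric `d` on the subset `K` of a normed space which dominates the distance of the norm, and
exceeds it by at most `C ‖x - y‖ ^ 3` at scales below `h₀`. This is how the intrinsic metric of a
set of positive reach compares with the Euclidean one. -/
structure IsNearEuclideanMetric {E : Type*} [NormedAddCommGroup E] (K : Set E) (d : E → E → ℝ)
    (C h₀ : ℝ) : Prop where
  C_nonneg : 0 ≤ C
  h₀_pos : 0 < h₀
  comm : ∀ x ∈ K, ∀ y ∈ K, d x y = d y x
  triangle : ∀ x ∈ K, ∀ y ∈ K, ∀ z ∈ K, d x z ≤ d x y + d y z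
  norm_le : ∀ x ∈ K, ∀ y ∈ K, ‖x - y‖ ≤ d x y
  le_add_cube : ∀ x ∈ K, ∀ y ∈ K, ‖x - y‖ ≤ h₀ → d x y ≤ ‖x - y‖ + C * ‖x - y‖ ^ 3

namespace IsNearEuclideanMetric

variable {E : Type*} [NormedAddCommGroup E] {K : Set E} {d : E → E → ℝ} {C h₀ : ℝ}

theorem nonneg (hd : IsNearEuclideanMetric K d C h₀) {x y : E} (hx : x ∈ K) (hy : y ∈ K) :
    0 ≤ d x y :=
  (norm_nonneg _).trans (hd.norm_le x hx y hy)

theorem self (hd : IsNearEuclideanMetric K d C h₀) {x : E} (hx : x ∈ K) : d x x = 0 := by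
  refine le_antisymm ?_ (hd.nonneg hx hx)
  simpa using hd.le_add_cube x hx x hx (by simpa using hd.h₀_pos.le)

theorem eq_of_le_zero (hd : IsNearEuclideanMetric K d C h₀) {x y : E} (hx : x ∈ K) (hy : y ∈ K)
    (h : d x y ≤ 0) : x = y :=
  sub_eq_zero.1 (norm_le_zero_iff.1 ((hd.norm_le x hx y hy).trans h))

theorem le_mul (hd : IsNearEuclideanMetric K d C h₀) {x y : E} (hx : x ∈ K) (hy : y ∈ K)
    (h : ‖x - y‖ ≤ h₀) : d x y ≤ (1 + C * h₀ ^ 2) * ‖x - y‖ := by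
  refine (hd.le_add_cube x hx y hy h).trans ?_
  have h1 : ‖x - y‖ ^ 2 ≤ h₀ ^ 2 := by gcongr
  have h2 : C * ‖x - y‖ ^ 2 ≤ C * h₀ ^ 2 := mul_le_mul_of_nonneg_left h1 hd.C_nonneg
  nlinarith [norm_nonneg (x - y)]

theorem abs_sub_le (hd : IsNearEuclideanMetric K d C h₀) {x y x' y' : E} (hx : x ∈ K) (hy : y ∈ K)
    (hx' : x' ∈ K) (hy' : y' ∈ K) : |d x y - d x' y'| ≤ d x x' + d y y' := by
  have h1 := hd.triangle x hx x' hx' y hy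
  have h2 := hd.triangle x' hx' y' hy' y hy
  have h3 := hd.triangle x' hx' x hx y' hy'
  have h4 := hd.triangle x hx y hy y' hy'
  have h5 := hd.comm x hx x' hx'
  have h6 := hd.comm y hy y' hy'
  rw [abs_le]
  constructor <;> linarith

theorem tendsto_zero (hd : IsNearEuclideanMetric K d C h₀) {ι : Type*} {l : Filter ι} {u : ι → E}
    {x : E} (hu : ∀ᶠ i in l, u i ∈ K) (hx : x ∈ K) (h : Tendsto u l (𝓝 x)) :
    Tendsto (fun i => d (u i) x) l (𝓝 0) := by
  have h1 : Tendsto (fun i => ‖u i - x‖) l (𝓝 0) := tendsto_iff_norm_sub_tendsto_zero.1 h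
  have h2 : Tendsto (fun i => (1 + C * h₀ ^ 2) * ‖u i - x‖) l (𝓝 0) := by
    simpa using h1.const_mul (1 + C * h₀ ^ 2)
  refine squeeze_zero' (hu.mono fun i hi => hd.nonneg hi hx) ?_ h2
  filter_upwards [hu, h1.eventually (gt_mem_nhds hd.h₀_pos)] with i hi hi'
  exact hd.le_mul hi hx hi'.le

theorem tendsto (hd : IsNearEuclideanMetric K d C h₀) {ι : Type*} {l : Filter ι} {u v : ι → E}
    {x y : E} (hu : ∀ᶠ i in l, u i ∈ K) (hv : ∀ᶠ i in l, v i ∈ K) (hx : x ∈ K) (hy : y ∈ K)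
    (hux : Tendsto u l (𝓝 x)) (hvy : Tendsto v l (𝓝 y)) :
    Tendsto (fun i => d (u i) (v i)) l (𝓝 (d x y)) := by
  rw [tendsto_iff_norm_sub_tendsto_zero]
  have h0 := (hd.tendsto_zero hu hx hux).add (hd.tendsto_zero hv hy hvy)
  rw [add_zero] at h0
  refine squeeze_zero' (Eventually.of_forall fun _ => norm_nonneg _) ?_ h0
  filter_upwards [hu, hv] with i hui hvi
  exact hd.abs_sub_le hui hvi hx hy

end IsNearEuclideanMetric

section Closure

variable {n : ℕ} {D : Set (EuclideanSpace ℝ (Fin n))} {r δ α : ℝ}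

theorem pathEDist_toReal_le_two_mul (hD : IsOpen D) (hr : 0 < r) (hs : UniformExteriorSphere D r)
    (hδ : 0 < δ) (hα : α ∈ Ioc 0 (Real.pi / 2)) (hcone : UniformInteriorCone D δ α)
    {x y : EuclideanSpace ℝ (Fin n)} (hx : x ∈ D) (hy : y ∈ D) (hxr : ‖x - y‖ ≤ 2 * r / 3)
    (hxδ : ‖x - y‖ ≤ δ / 16) : (pathEDist D x y).toReal ≤ 2 * ‖x - y‖ := by
  refine ENNReal.toReal_le_of_le_ofReal (by positivity)
    ((pathEDist_le_of_norm_le hD hr hs hδ hα hcone hx hy hxr hxδ).trans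
      (ENNReal.ofReal_le_ofReal ?_))
  have : ‖x - y‖ ^ 3 / (4 * r ^ 2) ≤ ‖x - y‖ := by
    rw [div_le_iff₀ (by positivity)]
    have : ‖x - y‖ ^ 2 ≤ (2 * r / 3) ^ 2 := by gcongr
    have h2 : ‖x - y‖ ^ 2 ≤ 4 * r ^ 2 := by nlinarith [sq_nonneg r]
    nlinarith [norm_nonneg (x - y)]
  linarith

theorem pathEDist_toReal_triangle (hD : IsOpen D) (hc : IsConnected D)
    {x y z : EuclideanSpace ℝ (Fin n)} (hx : x ∈ D) (hy : y ∈ D) (hz : z ∈ D) :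
    (pathEDist D x z).toReal ≤ (pathEDist D x y).toReal + (pathEDist D y z).toReal := by
  have h1 := pathEDist_ne_top hD hc hx hy
  have h2 := pathEDist_ne_top hD hc hy hz
  rw [← ENNReal.toReal_add h1 h2]
  exact ENNReal.toReal_mono (ENNReal.add_ne_top.2 ⟨h1, h2⟩) pathEDist_triangle

/-- The lower limit that defines the intrinsic distance on the closure is a limit. -/
theorem intrinsicEDist_ne_top_and_tendsto (hD : IsOpen D) (hc : IsConnected D) (hr : 0 < r)
    (hs : UniformExteriorSphere D r) (hδ : 0 < δ) (hα : α ∈ Ioc 0 (Real.pi / 2))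
    (hcone : UniformInteriorCone D δ α) {x y : EuclideanSpace ℝ (Fin n)} (hx : x ∈ closure D)
    (hy : y ∈ closure D) :
    intrinsicEDist D x y ≠ ⊤ ∧
      Tendsto (fun p : EuclideanSpace ℝ (Fin n) × EuclideanSpace ℝ (Fin n) =>
        (pathEDist D p.1 p.2).toReal) (𝓝[D] x ×ˢ 𝓝[D] y) (𝓝 (intrinsicDist D x y)) := by
  have := mem_closure_iff_nhdsWithin_neBot.1 hx
  have := mem_closure_iff_nhdsWithin_neBot.1 hy
  set F := 𝓝[D] x ×ˢ 𝓝[D] y with hF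
  have hmem : ∀ η > 0, (D ∩ Metric.ball x η) ×ˢ (D ∩ Metric.ball y η) ∈ F := fun η hη =>
    prod_mem_prod (inter_mem self_mem_nhdsWithin
      (mem_nhdsWithin_of_mem_nhds (Metric.ball_mem_nhds x hη)))
      (inter_mem self_mem_nhdsWithin (mem_nhdsWithin_of_mem_nhds (Metric.ball_mem_nhds y hη)))
  have hcauchy : Cauchy (map (fun p : EuclideanSpace ℝ (Fin n) × EuclideanSpace ℝ (Fin n) =>
      (pathEDist D p.1 p.2).toReal) F) := by
    rw [Metric.cauchy_iff]
    refine ⟨inferInstance, fun ε hε => ?_⟩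
    obtain ⟨η, hη, h1, h2, h3⟩ : ∃ η : ℝ, 0 < η ∧ 2 * η ≤ 2 * r / 3 ∧ 2 * η ≤ δ / 16 ∧
        8 * η < ε := by
      refine ⟨min (r / 3) (min (δ / 32) (ε / 16)), by positivity, ?_, ?_, ?_⟩
      · linarith [min_le_left (r / 3) (min (δ / 32) (ε / 16))]
      · linarith [min_le_right (r / 3) (min (δ / 32) (ε / 16)), min_le_left (δ / 32) (ε / 16)]
      · linarith [min_le_right (r / 3) (min (δ / 32) (ε / 16)), min_le_right (δ / 32) (ε / 16)]
    refine ⟨_, image_mem_map (hmem η hη), ?_⟩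
    have hclose : ∀ (c u v : EuclideanSpace ℝ (Fin n)), u ∈ D ∩ Metric.ball c η →
        v ∈ D ∩ Metric.ball c η → (pathEDist D u v).toReal ≤ 4 * η := by
      intro c u v hu hv
      have huv : ‖u - v‖ ≤ 2 * η := by
        rw [← dist_eq_norm]
        have := dist_triangle_right u v c
        have h4 := Metric.mem_ball.1 hu.2
        have h5 := Metric.mem_ball.1 hv.2
        linarith
      have := pathEDist_toReal_le_two_mul hD hr hs hδ hα hcone hu.1 hv.1 (huv.trans h1)
        (huv.trans h2)
      linarith
    have hle : ∀ p q : EuclideanSpace ℝ (Fin n) × EuclideanSpace ℝ (Fin n),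
        p ∈ (D ∩ Metric.ball x η) ×ˢ (D ∩ Metric.ball y η) →
        q ∈ (D ∩ Metric.ball x η) ×ˢ (D ∩ Metric.ball y η) →
        (pathEDist D p.1 p.2).toReal - (pathEDist D q.1 q.2).toReal < ε := by
      intro p q hp hq
      have t1 := pathEDist_toReal_triangle hD hc hp.1.1 hq.1.1 hp.2.1
      have t2 := pathEDist_toReal_triangle hD hc hq.1.1 hq.2.1 hp.2.1
      have c1 := hclose x _ _ hp.1 hq.1
      have c2 := hclose y _ _ hq.2 hp.2
      linarith
    rintro _ ⟨p, hp, rfl⟩ _ ⟨q, hq, rfl⟩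
    rw [Real.dist_eq, abs_lt]
    constructor
    · linarith [hle q p hq hp]
    · exact hle p q hp hq
  obtain ⟨L, hL⟩ := cauchy_map_iff_exists_tendsto.1 hcauchy
  have hL0 : 0 ≤ L := ge_of_tendsto hL (Eventually.of_forall fun _ => ENNReal.toReal_nonneg)
  have hE : Tendsto (fun p : EuclideanSpace ℝ (Fin n) × EuclideanSpace ℝ (Fin n) =>
      pathEDist D p.1 p.2) F (𝓝 (ENNReal.ofReal L)) := by
    refine (ENNReal.tendsto_ofReal hL).congr' ?_
    filter_upwards [hmem 1 one_pos] with p hp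
    exact ENNReal.ofReal_toReal (pathEDist_ne_top hD hc hp.1.1 hp.2.1)
  have hlim : intrinsicEDist D x y = ENNReal.ofReal L := hE.liminf_eq
  refine ⟨by rw [hlim]; exact ENNReal.ofReal_ne_top, ?_⟩
  rwa [intrinsicDist, hlim, ENNReal.toReal_ofReal hL0]

theorem tendsto_pathEDist_seq (hD : IsOpen D) (hc : IsConnected D) (hr : 0 < r)
    (hs : UniformExteriorSphere D r) (hδ : 0 < δ) (hα : α ∈ Ioc 0 (Real.pi / 2))
    (hcone : UniformInteriorCone D δ α) {x y : EuclideanSpace ℝ (Fin n)}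
    {u v : ℕ → EuclideanSpace ℝ (Fin n)} (hu : ∀ k, u k ∈ D) (hv : ∀ k, v k ∈ D)
    (hux : Tendsto u atTop (𝓝 x)) (hvy : Tendsto v atTop (𝓝 y)) :
    Tendsto (fun k => (pathEDist D (u k) (v k)).toReal) atTop (𝓝 (intrinsicDist D x y)) := by
  have h1 := (intrinsicEDist_ne_top_and_tendsto hD hc hr hs hδ hα hcone
    (mem_closure_of_tendsto hux (Eventually.of_forall hu))
    (mem_closure_of_tendsto hvy (Eventually.of_forall hv))).2
  have h2 : Tendsto (fun k => (u k, v k)) atTop (𝓝[D] x ×ˢ 𝓝[D] y) :=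
    (tendsto_nhdsWithin_iff.2 ⟨hux, Eventually.of_forall hu⟩).prodMk
      (tendsto_nhdsWithin_iff.2 ⟨hvy, Eventually.of_forall hv⟩)
  have h3 := h1.comp h2
  simpa only [Function.comp_def] using h3

theorem intrinsicDist_eq_of_mem (hD : IsOpen D) (hc : IsConnected D) (hr : 0 < r)
    (hs : UniformExteriorSphere D r) (hδ : 0 < δ) (hα : α ∈ Ioc 0 (Real.pi / 2))
    (hcone : UniformInteriorCone D δ α) {x y : EuclideanSpace ℝ (Fin n)} (hx : x ∈ D)
    (hy : y ∈ D) : intrinsicDist D x y = (pathEDist D x y).toReal :=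
  tendsto_nhds_unique (tendsto_pathEDist_seq hD hc hr hs hδ hα hcone (fun _ => hx) (fun _ => hy)
    tendsto_const_nhds tendsto_const_nhds) tendsto_const_nhds

theorem isNearEuclideanMetric_intrinsicDist (hD : IsOpen D) (hc : IsConnected D) (hr : 0 < r)
    (hs : UniformExteriorSphere D r) (hδ : 0 < δ) (hα : α ∈ Ioc 0 (Real.pi / 2))
    (hcone : UniformInteriorCone D δ α) :
    IsNearEuclideanMetric (closure D) (intrinsicDist D) (1 / (4 * r ^ 2))
      (min (r / 3) (δ / 32)) where
  C_nonneg := by positivity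
  h₀_pos := by positivity
  comm := by
    intro x hx y hy
    obtain ⟨u, hu, hux⟩ := mem_closure_iff_seq_limit.1 hx
    obtain ⟨v, hv, hvy⟩ := mem_closure_iff_seq_limit.1 hy
    refine tendsto_nhds_unique (tendsto_pathEDist_seq hD hc hr hs hδ hα hcone hu hv hux hvy)
      ((tendsto_pathEDist_seq hD hc hr hs hδ hα hcone hv hu hvy hux).congr fun k => ?_)
    rw [pathEDist_comm]
  triangle := by
    intro x hx y hy z hz
    obtain ⟨u, hu, hux⟩ := mem_closure_iff_seq_limit.1 hx
    obtain ⟨v, hv, hvy⟩ := mem_closure_iff_seq_limit.1 hy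
    obtain ⟨w, hw, hwz⟩ := mem_closure_iff_seq_limit.1 hz
    exact le_of_tendsto_of_tendsto' (tendsto_pathEDist_seq hD hc hr hs hδ hα hcone hu hw hux hwz)
      ((tendsto_pathEDist_seq hD hc hr hs hδ hα hcone hu hv hux hvy).add
        (tendsto_pathEDist_seq hD hc hr hs hδ hα hcone hv hw hvy hwz))
      fun k => pathEDist_toReal_triangle hD hc (hu k) (hv k) (hw k)
  norm_le := by
    intro x hx y hy
    obtain ⟨u, hu, hux⟩ := mem_closure_iff_seq_limit.1 hx
    obtain ⟨v, hv, hvy⟩ := mem_closure_iff_seq_limit.1 hy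
    refine le_of_tendsto_of_tendsto' (hux.sub hvy).norm
      (tendsto_pathEDist_seq hD hc hr hs hδ hα hcone hu hv hux hvy) fun k => ?_
    have := ENNReal.toReal_mono (pathEDist_ne_top hD hc (hu k) (hv k)) edist_le_pathEDist
    rwa [edist_dist, ENNReal.toReal_ofReal dist_nonneg, dist_eq_norm] at this
  le_add_cube := by
    intro x hx y hy hxy
    obtain ⟨u, hu, hux⟩ := mem_closure_iff_seq_limit.1 hx
    obtain ⟨v, hv, hvy⟩ := mem_closure_iff_seq_limit.1 hy
    have hn := (hux.sub hvy).norm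
    refine le_of_tendsto_of_tendsto (tendsto_pathEDist_seq hD hc hr hs hδ hα hcone hu hv hux hvy)
      (hn.add ((hn.pow 3).const_mul (1 / (4 * r ^ 2)))) ?_
    have h1 : ‖x - y‖ < 2 * r / 3 := by linarith [min_le_left (r / 3) (δ / 32)]
    have h2 : ‖x - y‖ < δ / 16 := by linarith [min_le_right (r / 3) (δ / 32)]
    filter_upwards [hn.eventually (gt_mem_nhds h1), hn.eventually (gt_mem_nhds h2)] with k hk1 hk2
    refine ENNReal.toReal_le_of_le_ofReal (by positivity) ?_
    have := pathEDist_le_of_norm_le hD hr hs hδ hα hcone (hu k) (hv k) hk1.le hk2.le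
    rwa [div_eq_inv_mul, ← one_div] at this

end Closure

/-! ### Geodesics -/

/-- `Γ`, restricted to `[0, d x y]`, is a geodesic from `x` to `y` of the metric `d` on `K`, that
is, an isometric embedding of the interval. -/
structure IsMetricGeodesic {E : Type*} (K : Set E) (d : E → E → ℝ) (x y : E) (Γ : ℝ → E) :
    Prop where
  mapsTo : MapsTo Γ (Icc 0 (d x y)) K
  source : Γ 0 = x
  target : Γ (d x y) = y
  dist_eq : ∀ s ∈ Icc 0 (d x y), ∀ t ∈ Icc 0 (d x y), s ≤ t → d (Γ s) (Γ t) = t - s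

namespace IsNearEuclideanMetric

variable {E : Type*} [NormedAddCommGroup E] {K : Set E} {d : E → E → ℝ} {C h₀ : ℝ}

/-- A path from `x` to `y` which is `1`-Lipschitz for `d` on an interval of length `d x y` is a
geodesic. -/
theorem isMetricGeodesic_of_le (hd : IsNearEuclideanMetric K d C h₀) {x y : E} {Γ : ℝ → E}
    (hx : x ∈ K) (hy : y ∈ K) (hm : MapsTo Γ (Icc 0 (d x y)) K) (h0 : Γ 0 = x)
    (h1 : Γ (d x y) = y)
    (h : ∀ s ∈ Icc 0 (d x y), ∀ t ∈ Icc 0 (d x y), s ≤ t → d (Γ s) (Γ t) ≤ t - s) :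
    IsMetricGeodesic K d x y Γ := by
  refine ⟨hm, h0, h1, fun s hs t ht hst => le_antisymm (h s hs t ht hst) ?_⟩
  have hL := hd.nonneg hx hy
  have e1 := h 0 ⟨le_rfl, hL⟩ s hs hs.1
  have e2 := h t ht (d x y) ⟨hL, le_rfl⟩ ht.2
  rw [h0] at e1
  rw [h1] at e2
  have t1 := hd.triangle x hx _ (hm hs) y hy
  have t2 := hd.triangle _ (hm hs) _ (hm ht) y hy
  linarith

theorem norm_le_of_geodesic (hd : IsNearEuclideanMetric K d C h₀) {x y : E} {Γ : ℝ → E}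
    (hΓ : IsMetricGeodesic K d x y Γ) {s t : ℝ} (hs : s ∈ Icc 0 (d x y)) (ht : t ∈ Icc 0 (d x y))
    (hst : s ≤ t) : ‖Γ s - Γ t‖ ≤ t - s :=
  (hd.norm_le _ (hΓ.mapsTo hs) _ (hΓ.mapsTo ht)).trans_eq (hΓ.dist_eq s hs t ht hst)

theorem le_norm_of_geodesic (hd : IsNearEuclideanMetric K d C h₀) {x y : E} {Γ : ℝ → E}
    (hΓ : IsMetricGeodesic K d x y Γ) {s t : ℝ} (hs : s ∈ Icc 0 (d x y)) (ht : t ∈ Icc 0 (d x y))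
    (hst : s ≤ t) (h : t - s ≤ h₀) : t - s - C * (t - s) ^ 3 ≤ ‖Γ s - Γ t‖ := by
  have h1 := hd.norm_le_of_geodesic hΓ hs ht hst
  have h2 := hd.le_add_cube _ (hΓ.mapsTo hs) _ (hΓ.mapsTo ht) (h1.trans h)
  rw [hΓ.dist_eq s hs t ht hst] at h2
  have h3 : ‖Γ s - Γ t‖ ^ 3 ≤ (t - s) ^ 3 := by gcongr
  have h4 := mul_le_mul_of_nonneg_left h3 hd.C_nonneg
  linarith

theorem tendsto_cube_error (C a : ℝ) :
    Tendsto (fun N : ℕ => C * a ^ 3 / ((N : ℝ) + 1) ^ 2) atTop (𝓝 0) := by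
  have h := (tendsto_one_div_add_atTop_nhds_zero_nat (𝕜 := ℝ)).pow 2 |>.const_mul (C * a ^ 3)
  simp only [ne_eq, OfNat.ofNat_ne_zero, not_false_eq_true, zero_pow, mul_zero] at h
  refine h.congr fun N => ?_
  rw [div_pow, one_pow, mul_one_div]

theorem eventually_div_le (hd : IsNearEuclideanMetric K d C h₀) (a : ℝ) :
    ∀ᶠ N : ℕ in atTop, a / ((N : ℝ) + 1) ≤ h₀ := by
  have h := (tendsto_one_div_add_atTop_nhds_zero_nat (𝕜 := ℝ)).const_mul a
  rw [mul_zero] at h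
  refine (h.eventually (gt_mem_nhds hd.h₀_pos)).mono fun N hN => ?_
  rw [mul_one_div] at hN
  exact hN.le

theorem subdivision_mem {s t : ℝ} (hst : s ≤ t) {N i : ℕ} (hi : i ≤ N + 1) :
    s + i * ((t - s) / ((N : ℝ) + 1)) ∈ Icc s t := by
  have hN : (0 : ℝ) < (N : ℝ) + 1 := by positivity
  have hi' : (i : ℝ) ≤ (N : ℝ) + 1 := by exact_mod_cast hi
  have h1 : (i : ℝ) * ((t - s) / ((N : ℝ) + 1)) ≤ t - s := by
    rw [mul_div_assoc', div_le_iff₀ hN, mul_comm]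
    exact mul_le_mul_of_nonneg_left hi' (by linarith)
  have h2 : 0 ≤ (i : ℝ) * ((t - s) / ((N : ℝ) + 1)) :=
    mul_nonneg (by positivity) (div_nonneg (by linarith) hN.le)
  constructor <;> linarith

/-- Since `d` exceeds the Euclidean distance by a cubic term only, the `d`-length of a path is at
most its Euclidean length. -/
theorem le_of_lipschitz (hd : IsNearEuclideanMetric K d C h₀) {Γ : ℝ → E} {s t : ℝ} (hst : s ≤ t)
    (hm : MapsTo Γ (Icc s t) K)
    (h : ∀ a ∈ Icc s t, ∀ b ∈ Icc s t, a ≤ b → ‖Γ a - Γ b‖ ≤ b - a) : d (Γ s) (Γ t) ≤ t - s := by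
  have hlim : Tendsto (fun N : ℕ => (t - s) + C * (t - s) ^ 3 / ((N : ℝ) + 1) ^ 2) atTop
      (𝓝 (t - s)) := by
    simpa using (tendsto_cube_error C (t - s)).const_add (t - s)
  refine ge_of_tendsto hlim ?_
  filter_upwards [hd.eventually_div_le (t - s)] with N hN
  set τ := (t - s) / ((N : ℝ) + 1) with hτ
  have hN0 : (0 : ℝ) < (N : ℝ) + 1 := by positivity
  have hτ0 : 0 ≤ τ := div_nonneg (by linarith) hN0.le
  have hstep : ∀ i ≤ N + 1, d (Γ s) (Γ (s + i * τ)) ≤ i * (τ + C * τ ^ 3) := by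
    intro i hi
    induction i with
    | zero => simpa using (hd.self (hm ⟨le_rfl, hst⟩)).le
    | succ i ih =>
      have m1 := subdivision_mem hst (N := N) (i := i) (by omega)
      have m2 := subdivision_mem hst hi
      rw [← hτ] at m1 m2
      have htri := hd.triangle _ (hm ⟨le_rfl, hst⟩) _ (hm m1) _ (hm m2)
      have hn := h _ m1 _ m2 (by push_cast; nlinarith)
      have e : s + ((i + 1 : ℕ) : ℝ) * τ - (s + i * τ) = τ := by push_cast; ring
      rw [e] at hn
      have hc := hd.le_add_cube _ (hm m1) _ (hm m2) (hn.trans hN)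
      have h3 : ‖Γ (s + i * τ) - Γ (s + ((i + 1 : ℕ) : ℝ) * τ)‖ ^ 3 ≤ τ ^ 3 := by gcongr
      have h4 := mul_le_mul_of_nonneg_left h3 hd.C_nonneg
      have := ih (by omega)
      push_cast at *
      linarith
  have hfin := hstep (N + 1) le_rfl
  have e1 : ((N + 1 : ℕ) : ℝ) * τ = t - s := by
    push_cast; rw [hτ]; field_simp
  have e2 : ((N + 1 : ℕ) : ℝ) * (τ + C * τ ^ 3) = (t - s) + C * (t - s) ^ 3 / ((N : ℝ) + 1) ^ 2 := by
    push_cast; rw [hτ]; field_simp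
  rw [e2, e1, add_sub_cancel] at hfin
  exact hfin

theorem isMetricGeodesic_of_hasUnitSpeedOn (hd : IsNearEuclideanMetric K d C h₀) {x y : E}
    {Γ : ℝ → E} (hx : x ∈ K) (hy : y ∈ K) (hm : MapsTo Γ (Icc 0 (d x y)) K) (h0 : Γ 0 = x)
    (h1 : Γ (d x y) = y) (hu : HasUnitSpeedOn Γ (Icc 0 (d x y))) :
    IsMetricGeodesic K d x y Γ := by
  refine hd.isMetricGeodesic_of_le hx hy hm h0 h1 fun s hs t ht hst => ?_
  have hsub : Icc s t ⊆ Icc 0 (d x y) := Icc_subset_Icc hs.1 ht.2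
  refine hd.le_of_lipschitz hst (hm.mono_left hsub) fun a ha b hb hab => ?_
  have he := eVariationOn.edist_le Γ (s := Icc 0 (d x y) ∩ Icc a b)
    ⟨hsub ha, le_rfl, hab⟩ ⟨hsub hb, hab, le_rfl⟩
  rw [hu (hsub ha) (hsub hb), edist_dist, dist_eq_norm] at he
  have := (ENNReal.ofReal_le_ofReal_iff (by simpa using hab)).1 he
  simpa using this

theorem hasUnitSpeedOn_of_isMetricGeodesic (hd : IsNearEuclideanMetric K d C h₀) {x y : E}
    {Γ : ℝ → E} (hΓ : IsMetricGeodesic K d x y Γ) : HasUnitSpeedOn Γ (Icc 0 (d x y)) := by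
  intro s hs t ht
  rcases lt_or_ge t s with hts | hst
  · rw [Icc_eq_empty (not_le.2 hts), inter_empty, eVariationOn.subsingleton _ subsingleton_empty,
      ENNReal.ofReal_of_nonpos (by simpa using hts.le)]
  have hsub : Icc s t ⊆ Icc 0 (d x y) := Icc_subset_Icc hs.1 ht.2
  rw [inter_eq_right.2 hsub, NNReal.coe_one, one_mul]
  refine le_antisymm ?_ ?_
  · have hlip : LipschitzOnWith 1 Γ (Icc s t) := by
      refine LipschitzOnWith.of_dist_le_mul fun a ha b hb => ?_
      rw [NNReal.coe_one, one_mul, dist_eq_norm, Real.dist_eq]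
      rcases le_total a b with hab | hab
      · rw [abs_of_nonpos (by linarith), neg_sub]
        exact hd.norm_le_of_geodesic hΓ (hsub ha) (hsub hb) hab
      · rw [abs_of_nonneg (by linarith), norm_sub_rev]
        exact hd.norm_le_of_geodesic hΓ (hsub hb) (hsub ha) hab
    simpa using hlip.eVariationOn_Icc_le
  · have hlim : Tendsto (fun N : ℕ =>
        ENNReal.ofReal ((t - s) - C * (t - s) ^ 3 / ((N : ℝ) + 1) ^ 2)) atTop
        (𝓝 (ENNReal.ofReal (t - s))) := by
      refine ENNReal.tendsto_ofReal ?_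
      simpa using (tendsto_cube_error C (t - s)).const_sub (t - s)
    refine le_of_tendsto hlim ?_
    filter_upwards [hd.eventually_div_le (t - s)] with N hN
    set τ := (t - s) / ((N : ℝ) + 1) with hτ
    have hN0 : (0 : ℝ) < (N : ℝ) + 1 := by positivity
    have hτ0 : 0 ≤ τ := div_nonneg (by linarith) hN0.le
    have hsum := eVariationOn.sum_le_of_monotoneOn_Iic (f := Γ) (s := Icc s t) (n := N + 1)
      (u := fun i => s + i * τ)
      (fun i _ j _ hij => by
        have : (i : ℝ) ≤ j := by exact_mod_cast hij
        change s + i * τ ≤ s + j * τ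
        nlinarith)
      (fun i hi => subdivision_mem hst hi)
    refine le_trans ?_ hsum
    have hterm : ∀ i ∈ Finset.range (N + 1), ENNReal.ofReal (τ - C * τ ^ 3) ≤
        edist (Γ (s + ((i + 1 : ℕ) : ℝ) * τ)) (Γ (s + i * τ)) := by
      intro i hi
      have hi' := Finset.mem_range.1 hi
      have m1 := hsub (subdivision_mem hst (N := N) (i := i) (by omega))
      have m2 := hsub (subdivision_mem hst (N := N) (i := i + 1) (by omega))
      rw [← hτ] at m1 m2
      have e : s + ((i + 1 : ℕ) : ℝ) * τ - (s + i * τ) = τ := by push_cast; ring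
      have := hd.le_norm_of_geodesic hΓ m1 m2 (by linarith) (by rw [e]; exact hN)
      rw [e, ← dist_eq_norm, dist_comm] at this
      rw [edist_dist]
      exact ENNReal.ofReal_le_ofReal this
    refine le_trans ?_ (Finset.sum_le_sum hterm)
    rw [Finset.sum_const, Finset.card_range, nsmul_eq_mul, ← ENNReal.ofReal_natCast,
      ← ENNReal.ofReal_mul (by positivity)]
    refine ENNReal.ofReal_le_ofReal (le_of_eq ?_)
    push_cast
    rw [hτ]
    field_simp

/-- If the points `u k → x` and `v k → y` of a compact set are joined by paths that are Lipschitz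
with constants tending to `d x y`, then an ultrafilter limit of these paths, reparametrized, is a
geodesic. -/
theorem exists_isMetricGeodesic_of_approx (hd : IsNearEuclideanMetric K d C h₀) (hK : IsCompact K)
    {x y : E} (hx : x ∈ K) (hy : y ∈ K) {g : ℕ → ℝ → E} {M : ℕ → ℝ}
    (hg : ∀ k, ∀ s ∈ Icc (0 : ℝ) 1, g k s ∈ K) (h0 : Tendsto (fun k => g k 0) atTop (𝓝 x))
    (h1 : Tendsto (fun k => g k 1) atTop (𝓝 y)) (hM : Tendsto M atTop (𝓝 (d x y)))
    (hlip : ∀ k, ∀ s ∈ Icc (0 : ℝ) 1, ∀ t ∈ Icc (0 : ℝ) 1, s ≤ t →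
      d (g k s) (g k t) ≤ (t - s) * M k) :
    ∃ Γ, IsMetricGeodesic K d x y Γ := by
  set U : Ultrafilter ℕ := hyperfilter ℕ
  have hU : (U : Filter ℕ) ≤ atTop := Nat.hyperfilter_le_atTop
  have hex : ∀ s : ℝ, ∃ p, s ∈ Icc (0 : ℝ) 1 → p ∈ K ∧ Tendsto (fun k => g k s) U (𝓝 p) := by
    intro s
    by_cases hs : s ∈ Icc (0 : ℝ) 1
    · obtain ⟨p, hp, hlim⟩ := hK.ultrafilter_le_nhds (U.map fun k => g k s) (by
        rw [le_principal_iff]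
        exact (Eventually.of_forall fun k => hg k s hs : ∀ᶠ k in (U : Filter ℕ), g k s ∈ K))
      exact ⟨p, fun _ => ⟨hp, hlim⟩⟩
    · exact ⟨x, fun h => absurd h hs⟩
  choose G hG using hex
  have z0 : (0 : ℝ) ∈ Icc (0 : ℝ) 1 := by simp
  have z1 : (1 : ℝ) ∈ Icc (0 : ℝ) 1 := by simp
  have hG0 : G 0 = x := tendsto_nhds_unique (hG 0 z0).2 (h0.mono_left hU)
  have hG1 : G 1 = y := tendsto_nhds_unique (hG 1 z1).2 (h1.mono_left hU)
  have hGlip : ∀ s ∈ Icc (0 : ℝ) 1, ∀ t ∈ Icc (0 : ℝ) 1, s ≤ t →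
      d (G s) (G t) ≤ (t - s) * d x y := fun s hs t ht hst =>
    le_of_tendsto_of_tendsto' (hd.tendsto (Eventually.of_forall fun k => hg k s hs)
      (Eventually.of_forall fun k => hg k t ht) (hG s hs).1 (hG t ht).1 (hG s hs).2 (hG t ht).2)
      ((hM.mono_left hU).const_mul (t - s)) fun k => hlip k s hs t ht hst
  rcases (hd.nonneg hx hy).eq_or_lt with hL | hL
  · have hxy := hd.eq_of_le_zero hx hy hL.ge
    refine ⟨fun _ => x, hd.isMetricGeodesic_of_le hx hy (fun _ _ => hx) rfl hxy ?_⟩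
    intro s _ t _ hst
    rw [hd.self hx]
    linarith
  · have hdiv : ∀ s ∈ Icc 0 (d x y), s / d x y ∈ Icc (0 : ℝ) 1 := fun s hs =>
      ⟨div_nonneg hs.1 hL.le, (div_le_one hL).2 hs.2⟩
    refine ⟨fun s => G (s / d x y), hd.isMetricGeodesic_of_le hx hy
      (fun s hs => (hG _ (hdiv s hs)).1) (by simpa using hG0) (by simpa [hL.ne'] using hG1) ?_⟩
    intro s hs t ht hst
    refine (hGlip _ (hdiv s hs) _ (hdiv t ht) (by gcongr)).trans_eq ?_
    field_simp

end IsNearEuclideanMetric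

section Existence

variable {n : ℕ} {D : Set (EuclideanSpace ℝ (Fin n))} {r δ α : ℝ}

/-- Reparametrization, proportional to arc length, of an almost shortest path. -/
theorem exists_lipschitz_path (hD : IsOpen D) (hc : IsConnected D)
    {x y : EuclideanSpace ℝ (Fin n)} (hx : x ∈ D) (hy : y ∈ D) {M : ℝ}
    (hM : (pathEDist D x y).toReal < M) :
    ∃ g : ℝ → EuclideanSpace ℝ (Fin n), (∀ s ∈ Icc (0 : ℝ) 1, g s ∈ D) ∧ g 0 = x ∧ g 1 = y ∧
      ∀ s ∈ Icc (0 : ℝ) 1, ∀ t ∈ Icc (0 : ℝ) 1, s ≤ t →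
        (pathEDist D (g s) (g t)).toReal ≤ (t - s) * M := by
  have hM0 : 0 < M := ENNReal.toReal_nonneg.trans_lt hM
  have hlt : pathEDist D x y < ENNReal.ofReal M :=
    (ENNReal.lt_ofReal_iff_toReal_lt (pathEDist_ne_top hD hc hx hy)).2 hM
  obtain ⟨γ, hlt⟩ := iInf_lt_iff.1 hlt
  obtain ⟨hγ, hlt⟩ := iInf_lt_iff.1 hlt
  obtain ⟨κ, hκ⟩ := hγ.smooth.exists_lipschitzOnWith (by simp) (convex_Icc 0 1) isCompact_Icc
  have hfin : ∀ s t : ℝ, 0 ≤ s → t ≤ 1 → eVariationOn γ (Icc s t) ≠ ⊤ := fun s t hs ht =>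
    ((eVariationOn.mono γ (Icc_subset_Icc hs ht)).trans_lt (hlt.trans ENNReal.ofReal_lt_top)).ne
  set V : ℝ → ℝ := fun t => (eVariationOn γ (Icc 0 t)).toReal with hV
  have hV0 : V 0 = 0 := by simp [hV, eVariationOn.subsingleton]
  have hVM : V 1 ≤ M := ENNReal.toReal_le_of_le_ofReal hM0.le hlt.le
  have hVadd : ∀ s t : ℝ, 0 ≤ s → s ≤ t → t ≤ 1 →
      V t - V s = (eVariationOn γ (Icc s t)).toReal := by
    intro s t hs hst ht
    have h := eVariationOn.Icc_add_Icc γ (s := univ) hs hst (mem_univ _)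
    simp only [univ_inter] at h
    simp only [hV]
    rw [← h, ENNReal.toReal_add (hfin 0 s le_rfl (hst.trans ht)) (hfin s t hs ht)]
    ring
  have hVlip : LipschitzOnWith κ V (Icc 0 1) := by
    have key : ∀ s t : ℝ, 0 ≤ s → s ≤ t → t ≤ 1 → |V t - V s| ≤ κ * (t - s) := by
      intro s t hs hst ht
      rw [hVadd s t hs hst ht, abs_of_nonneg ENNReal.toReal_nonneg]
      refine ENNReal.toReal_le_of_le_ofReal (mul_nonneg κ.coe_nonneg (by linarith)) ?_
      have h := (hκ.mono (Icc_subset_Icc hs ht)).eVariationOn_Icc_le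
      rwa [← ENNReal.ofReal_coe_nnreal, ← ENNReal.ofReal_mul κ.coe_nonneg] at h
    refine LipschitzOnWith.of_dist_le_mul fun a ha b hb => ?_
    rw [Real.dist_eq, Real.dist_eq]
    rcases le_total a b with hab | hab
    · rw [abs_sub_comm, abs_sub_comm a b, abs_of_nonneg (a := b - a) (by linarith)]
      exact key a b ha.1 hab hb.2
    · rw [abs_of_nonneg (a := a - b) (by linarith)]
      exact key b a hb.1 hab ha.2
  have hVmono : ∀ s t : ℝ, 0 ≤ s → s ≤ t → t ≤ 1 → V s ≤ V t := fun s t hs hst ht => by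
    have := hVadd s t hs hst ht
    have h0 : 0 ≤ (eVariationOn γ (Icc s t)).toReal := ENNReal.toReal_nonneg
    linarith
  have hV1 : 0 ≤ V 1 := ENNReal.toReal_nonneg
  have hdist : ∀ a ∈ Icc (0 : ℝ) 1, ∀ b ∈ Icc (0 : ℝ) 1,
      (pathEDist D (γ a) (γ b)).toReal ≤ |V a - V b| := by
    have key : ∀ s t : ℝ, 0 ≤ s → s ≤ t → t ≤ 1 →
        (pathEDist D (γ s) (γ t)).toReal ≤ V t - V s := by
      intro s t hs hst ht
      rw [hVadd s t hs hst ht]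
      exact ENNReal.toReal_mono (hfin s t hs ht) (hγ.pathEDist_le_subpath hs hst ht)
    intro a ha b hb
    rcases le_total a b with hab | hab
    · rw [abs_sub_comm]
      exact (key a b ha.1 hab hb.2).trans (le_abs_self _)
    · rw [pathEDist_comm]
      exact (key b a hb.1 hab ha.2).trans (le_abs_self _)
  have hsurj : ∀ s : ℝ, ∃ τ, s ∈ Icc (0 : ℝ) 1 → τ ∈ Icc (0 : ℝ) 1 ∧ V τ = s * V 1 := by
    intro s
    by_cases hs : s ∈ Icc (0 : ℝ) 1
    · obtain ⟨τ, hτ, h⟩ := intermediate_value_Icc zero_le_one hVlip.continuousOn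
        (show s * V 1 ∈ Icc (V 0) (V 1) by
          rw [hV0]
          exact ⟨mul_nonneg hs.1 hV1, mul_le_of_le_one_left hV1 hs.2⟩)
      exact ⟨τ, fun _ => ⟨hτ, h⟩⟩
    · exact ⟨0, fun h => absurd h hs⟩
  choose τ hτ using hsurj
  have z0 : (0 : ℝ) ∈ Icc (0 : ℝ) 1 := by simp
  have z1 : (1 : ℝ) ∈ Icc (0 : ℝ) 1 := by simp
  have heq : ∀ a ∈ Icc (0 : ℝ) 1, ∀ b ∈ Icc (0 : ℝ) 1, V a = V b → γ a = γ b := by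
    intro a ha b hb hab
    have h := hdist a ha b hb
    rw [hab, sub_self, abs_zero] at h
    have h0 : pathEDist D (γ a) (γ b) = 0 :=
      ((ENNReal.toReal_eq_zero_iff _).1 (le_antisymm h ENNReal.toReal_nonneg)).resolve_right
        (pathEDist_ne_top hD hc (hγ.mapsTo ha) (hγ.mapsTo hb))
    have := edist_le_pathEDist (D := D) (x := γ a) (y := γ b)
    rw [h0] at this
    exact edist_le_zero.1 this
  refine ⟨fun s => γ (τ s), fun s hs => hγ.mapsTo (hτ s hs).1, ?_, ?_, ?_⟩
  · rw [← hγ.source]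
    exact heq _ (hτ 0 z0).1 _ z0 (by rw [(hτ 0 z0).2, hV0, zero_mul])
  · rw [← hγ.target]
    exact heq _ (hτ 1 z1).1 _ z1 (by rw [(hτ 1 z1).2, one_mul])
  · intro s hs t ht hst
    refine (hdist _ (hτ s hs).1 _ (hτ t ht).1).trans ?_
    rw [(hτ s hs).2, (hτ t ht).2, ← sub_mul, abs_mul, abs_of_nonneg hV1, abs_sub_comm,
      abs_of_nonneg (by linarith)]
    exact mul_le_mul_of_nonneg_left hVM (by linarith)

theorem exists_isMetricGeodesic (hD : IsOpen D) (hc : IsConnected D) (hb : Bornology.IsBounded D)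
    (hr : 0 < r) (hs : UniformExteriorSphere D r) (hδ : 0 < δ) (hα : α ∈ Ioc 0 (Real.pi / 2))
    (hcone : UniformInteriorCone D δ α) {x y : EuclideanSpace ℝ (Fin n)} (hx : x ∈ closure D)
    (hy : y ∈ closure D) : ∃ Γ, IsMetricGeodesic (closure D) (intrinsicDist D) x y Γ := by
  have hd := isNearEuclideanMetric_intrinsicDist hD hc hr hs hδ hα hcone
  obtain ⟨u, hu, hux⟩ := mem_closure_iff_seq_limit.1 hx
  obtain ⟨v, hv, hvy⟩ := mem_closure_iff_seq_limit.1 hy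
  have hM := (tendsto_pathEDist_seq hD hc hr hs hδ hα hcone hu hv hux hvy).add
    (tendsto_one_div_add_atTop_nhds_zero_nat (𝕜 := ℝ))
  rw [add_zero] at hM
  have hex := fun k : ℕ => exists_lipschitz_path hD hc (hu k) (hv k)
    (M := (pathEDist D (u k) (v k)).toReal + 1 / ((k : ℝ) + 1))
    (lt_add_of_pos_right _ (by positivity))
  choose g hgD hg0 hg1 hlip using hex
  refine hd.exists_isMetricGeodesic_of_approx hb.isCompact_closure hx hy
    (fun k s hs => subset_closure (hgD k s hs)) (by simpa [hg0] using hux)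
    (by simpa [hg1] using hvy) hM fun k s hs' t ht hst => ?_
  rw [intrinsicDist_eq_of_mem hD hc hr hs hδ hα hcone (hgD k s hs') (hgD k t ht)]
  exact hlip k s hs' t ht hst

theorem isIntrinsicGeodesic_iff (hD : IsOpen D) (hc : IsConnected D)
    (hr : 0 < r) (hs : UniformExteriorSphere D r) (hδ : 0 < δ) (hα : α ∈ Ioc 0 (Real.pi / 2))
    (hcone : UniformInteriorCone D δ α) {x y : EuclideanSpace ℝ (Fin n)} (hx : x ∈ closure D)
    (hy : y ∈ closure D) {Γ : ℝ → EuclideanSpace ℝ (Fin n)} :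
    IsIntrinsicGeodesic D x y Γ ↔ IsMetricGeodesic (closure D) (intrinsicDist D) x y Γ := by
  have hd := isNearEuclideanMetric_intrinsicDist hD hc hr hs hδ hα hcone
  exact ⟨fun h => hd.isMetricGeodesic_of_hasUnitSpeedOn hx hy h.mapsTo h.source h.target
    h.unitSpeed, fun h => ⟨h.mapsTo, h.source, h.target, hd.hasUnitSpeedOn_of_isMetricGeodesic h⟩⟩

end Existence

/-! ### Nonpositive curvature on the closure -/

/-- `(K, d)` is a geodesic space of nonpositive curvature, in the form of the inequality of Bruhat
and Tits for all points of the sides opposite to a vertex `c`. -/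
structure IsBruhatTitsMetric {E : Type*} (K : Set E) (d : E → E → ℝ) : Prop where
  exists_geodesic : ∀ x ∈ K, ∀ y ∈ K, ∃ Γ, IsMetricGeodesic K d x y Γ
  sq_le : ∀ x ∈ K, ∀ y ∈ K, ∀ c ∈ K, ∀ Γ, IsMetricGeodesic K d x y Γ → ∀ w ∈ Icc (0 : ℝ) 1,
    d c (Γ (w * d x y)) ^ 2 ≤ (1 - w) * d c x ^ 2 + w * d c y ^ 2 - w * (1 - w) * d x y ^ 2

/-- Stewart's theorem. -/
theorem dist_lineMap_sq {E : Type*} [NormedAddCommGroup E] [InnerProductSpace ℝ E] (a b c : E)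
    (w : ℝ) : dist (AffineMap.lineMap a b w : E) c ^ 2 =
      (1 - w) * dist a c ^ 2 + w * dist b c ^ 2 - w * (1 - w) * dist a b ^ 2 := by
  have e1 : (AffineMap.lineMap a b w : E) - c = (1 - w) • (a - c) + w • (b - c) := by
    rw [AffineMap.lineMap_apply_module]; module
  have e2 : a - b = (a - c) - (b - c) := by abel
  rw [dist_eq_norm, dist_eq_norm, dist_eq_norm, dist_eq_norm, e1, e2, norm_add_sq_real,
    norm_sub_sq_real (a - c), norm_smul, norm_smul, mul_pow, mul_pow, inner_smul_left, inner_smul_right,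
    Real.norm_eq_abs, Real.norm_eq_abs, sq_abs, sq_abs]
  simp only [conj_trivial]
  ring

/-- A Euclidean triangle with given side lengths. -/
theorem exists_euclidean_triangle {A B C : ℝ} (hA : 0 ≤ A) (hB : 0 ≤ B) (hC : 0 ≤ C)
    (h1 : A ≤ B + C) (h2 : B ≤ A + C) (h3 : C ≤ A + B) :
    ∃ a b c : EuclideanSpace ℝ (Fin 2), dist a b = A ∧ dist a c = B ∧ dist b c = C := by
  obtain ⟨p, hp, hpB⟩ : ∃ p : ℝ, 2 * A * p = A ^ 2 + B ^ 2 - C ^ 2 ∧ p ^ 2 ≤ B ^ 2 := by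
    rcases hA.eq_or_lt with rfl | hA
    · refine ⟨0, ?_, by rw [zero_pow two_ne_zero]; exact sq_nonneg B⟩
      have : B = C := by linarith
      subst this
      ring
    · refine ⟨(A ^ 2 + B ^ 2 - C ^ 2) / (2 * A), by field_simp, ?_⟩
      rw [div_pow, div_le_iff₀ (by positivity)]
      have h4 : A ^ 2 + B ^ 2 - C ^ 2 ≤ 2 * A * B := by nlinarith
      have h5 : -(2 * A * B) ≤ A ^ 2 + B ^ 2 - C ^ 2 := by nlinarith
      have := sq_le_sq' h5 h4
      linarith
  have hq : √(B ^ 2 - p ^ 2) ^ 2 = B ^ 2 - p ^ 2 := Real.sq_sqrt (by linarith)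
  refine ⟨!₂[0, 0], !₂[A, 0], !₂[p, √(B ^ 2 - p ^ 2)], ?_, ?_, ?_⟩
  · rw [EuclideanSpace.dist_eq, Fin.sum_univ_two]
    simp [Real.dist_eq, Real.sqrt_sq hA]
  · rw [EuclideanSpace.dist_eq, Fin.sum_univ_two, Real.sqrt_eq_iff_mul_self_eq (by positivity) hB]
    simp only [Real.dist_eq, sq_abs]
    simp
    linarith
  · rw [EuclideanSpace.dist_eq, Fin.sum_univ_two, Real.sqrt_eq_iff_mul_self_eq (by positivity) hC]
    simp only [Real.dist_eq, sq_abs]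
    simp
    linarith

/-- A point that satisfies the inequality of Bruhat and Tits is the corresponding point of every
geodesic. -/
theorem IsNearEuclideanMetric.geodesic_eq {E : Type*} [NormedAddCommGroup E] {K : Set E}
    {d : E → E → ℝ} {C h₀ : ℝ} (hd : IsNearEuclideanMetric K d C h₀) {x y p : E} (hx : x ∈ K)
    (hy : y ∈ K) (hp : p ∈ K) {w : ℝ} (hw : w ∈ Icc (0 : ℝ) 1)
    (h : ∀ c ∈ K, d c p ^ 2 ≤ (1 - w) * d c x ^ 2 + w * d c y ^ 2 - w * (1 - w) * d x y ^ 2)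
    {Γ : ℝ → E} (hΓ : IsMetricGeodesic K d x y Γ) : Γ (w * d x y) = p := by
  have hL := hd.nonneg hx hy
  have hm : w * d x y ∈ Icc 0 (d x y) :=
    ⟨mul_nonneg hw.1 hL, mul_le_of_le_one_left hL hw.2⟩
  have hc := h _ (hΓ.mapsTo hm)
  have e1 := hΓ.dist_eq 0 ⟨le_rfl, hL⟩ _ hm hm.1
  have e2 := hΓ.dist_eq _ hm (d x y) ⟨hL, le_rfl⟩ hm.2
  rw [hΓ.source, hd.comm _ hx _ (hΓ.mapsTo hm)] at e1
  rw [hΓ.target] at e2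
  rw [e1, e2] at hc
  refine hd.eq_of_le_zero (hΓ.mapsTo hm) hp (pow_eq_zero_iff two_ne_zero |>.1 ?_).le
  refine le_antisymm (hc.trans_eq ?_) (sq_nonneg _)
  ring

section Comparison

variable {n : ℕ} {D : Set (EuclideanSpace ℝ (Fin n))} {r δ α : ℝ}

theorem IsCAT0Domain.sq_le (hCAT : IsCAT0Domain D) (hb : Bornology.IsBounded D)
    (hr : 0 < r) (hs : UniformExteriorSphere D r) (hδ : 0 < δ) (hα : α ∈ Ioc 0 (Real.pi / 2))
    (hcone : UniformInteriorCone D δ α) {a b c : EuclideanSpace ℝ (Fin n)} (ha : a ∈ D)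
    (hb' : b ∈ D) (hc : c ∈ D) {Γ : ℝ → EuclideanSpace ℝ (Fin n)}
    (hΓ : IsMetricGeodesic (closure D) (intrinsicDist D) a b Γ) {w : ℝ}
    (hw : w ∈ Icc (0 : ℝ) 1) :
    intrinsicDist D c (Γ (w * intrinsicDist D a b)) ^ 2 ≤ (1 - w) * intrinsicDist D c a ^ 2 +
      w * intrinsicDist D c b ^ 2 - w * (1 - w) * intrinsicDist D a b ^ 2 := by
  have hd := isNearEuclideanMetric_intrinsicDist hCAT.isOpen hCAT.isConnected hr hs hδ hα hcone
  have hac := subset_closure ha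
  have hbc := subset_closure hb'
  have hcc := subset_closure hc
  obtain ⟨Γac, hΓac⟩ := exists_isMetricGeodesic hCAT.isOpen hCAT.isConnected hb hr hs hδ hα hcone
    hac hcc
  obtain ⟨Γbc, hΓbc⟩ := exists_isMetricGeodesic hCAT.isOpen hCAT.isConnected hb hr hs hδ hα hcone
    hbc hcc
  have hL := hd.nonneg hac hbc
  have hm : w * intrinsicDist D a b ∈ Icc 0 (intrinsicDist D a b) :=
    ⟨mul_nonneg hw.1 hL, mul_le_of_le_one_left hL hw.2⟩
  have t1 := hd.triangle a hac c hcc b hbc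
  have t2 := hd.triangle a hac b hbc c hcc
  have t3 := hd.triangle b hbc a hac c hcc
  rw [hd.comm c hcc b hbc] at t1
  rw [hd.comm b hbc a hac] at t3
  obtain ⟨a', b', c', h1, h2, h3⟩ := exists_euclidean_triangle hL (hd.nonneg hac hcc)
    (hd.nonneg hbc hcc) t1 t2 t3
  have hcomp := hCAT.comparison a ha b hb' c hc Γ Γac Γbc
    ((isIntrinsicGeodesic_iff hCAT.isOpen hCAT.isConnected hr hs hδ hα hcone hac hbc).2 hΓ)
    ((isIntrinsicGeodesic_iff hCAT.isOpen hCAT.isConnected hr hs hδ hα hcone hac hcc).2 hΓac)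
    ((isIntrinsicGeodesic_iff hCAT.isOpen hCAT.isConnected hr hs hδ hα hcone hbc hcc).2 hΓbc)
    a' b' c' h1 h2 h3 _ hm _ ⟨hd.nonneg hac hcc, le_rfl⟩
  -- the parameters of the comparison points are also right for degenerate sides
  have e1 : (AffineMap.lineMap a' b' (w * intrinsicDist D a b / dist a' b') :
      EuclideanSpace ℝ (Fin 2)) = AffineMap.lineMap a' b' w := by
    rcases eq_or_ne a' b' with rfl | hne
    · simp
    · rw [← h1, mul_div_assoc, div_self (dist_ne_zero.2 hne), mul_one]
  have e2 : (AffineMap.lineMap a' c' (intrinsicDist D a c / dist a' c') :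
      EuclideanSpace ℝ (Fin 2)) = c' := by
    rcases eq_or_ne a' c' with rfl | hne
    · simp
    · rw [← h2, div_self (dist_ne_zero.2 hne), AffineMap.lineMap_apply_one]
  rw [e1, e2, hΓac.target] at hcomp
  have hle := ENNReal.toReal_mono (edist_ne_top _ _) hcomp
  rw [edist_dist, ENNReal.toReal_ofReal dist_nonneg] at hle
  change intrinsicDist D _ _ ≤ _ at hle
  rw [hd.comm _ hcc _ (hΓ.mapsTo hm), hd.comm c hcc a hac, hd.comm c hcc b hbc, ← h1, ← h2, ← h3,
    ← dist_lineMap_sq]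
  have h0 := hd.nonneg (hΓ.mapsTo hm) hcc
  rw [← h1] at hle h0
  gcongr

/-- The inequality passes to the closure: points of geodesics between approximating points of `D`
accumulate at a point that satisfies it, and `IsNearEuclideanMetric.geodesic_eq` identifies that
point. -/
theorem IsCAT0Domain.isBruhatTitsMetric (hCAT : IsCAT0Domain D) (hb : Bornology.IsBounded D)
    (hr : 0 < r) (hs : UniformExteriorSphere D r) (hδ : 0 < δ) (hα : α ∈ Ioc 0 (Real.pi / 2))
    (hcone : UniformInteriorCone D δ α) :
    IsBruhatTitsMetric (closure D) (intrinsicDist D) := by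
  have hd := isNearEuclideanMetric_intrinsicDist hCAT.isOpen hCAT.isConnected hr hs hδ hα hcone
  have hgeo := fun x hx y hy => exists_isMetricGeodesic (x := x) (y := y) hCAT.isOpen
    hCAT.isConnected hb hr hs hδ hα hcone hx hy
  refine ⟨hgeo, ?_⟩
  intro x hx y hy c hc Γ hΓ w hw
  obtain ⟨u, hu, hux⟩ := mem_closure_iff_seq_limit.1 hx
  obtain ⟨v, hv, hvy⟩ := mem_closure_iff_seq_limit.1 hy
  have hu' := fun k => subset_closure (hu k)
  have hv' := fun k => subset_closure (hv k)
  choose G hG using fun k => hgeo (u k) (hu' k) (v k) (hv' k)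
  have hGm : ∀ k, G k (w * intrinsicDist D (u k) (v k)) ∈ closure D := fun k =>
    (hG k).mapsTo ⟨mul_nonneg hw.1 (hd.nonneg (hu' k) (hv' k)),
      mul_le_of_le_one_left (hd.nonneg (hu' k) (hv' k)) hw.2⟩
  obtain ⟨p, hp, φ, hφ, hlim⟩ := hb.isCompact_closure.tendsto_subseq hGm
  have huφ := hux.comp hφ.tendsto_atTop
  have hvφ := hvy.comp hφ.tendsto_atTop
  have hD : ∀ c ∈ D, intrinsicDist D c p ^ 2 ≤ (1 - w) * intrinsicDist D c x ^ 2 +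
      w * intrinsicDist D c y ^ 2 - w * (1 - w) * intrinsicDist D x y ^ 2 := by
    intro c hc
    have hcc := subset_closure hc
    have hc' : ∀ᶠ k : ℕ in atTop, c ∈ closure D := Eventually.of_forall fun _ => hcc
    have l0 := hd.tendsto hc' (Eventually.of_forall fun k => hGm (φ k)) hcc hp
      tendsto_const_nhds hlim
    have l1 := hd.tendsto hc' (Eventually.of_forall fun k => hu' (φ k)) hcc hx
      tendsto_const_nhds huφ
    have l2 := hd.tendsto hc' (Eventually.of_forall fun k => hv' (φ k)) hcc hy
      tendsto_const_nhds hvφ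
    have l3 := hd.tendsto (Eventually.of_forall fun k => hu' (φ k))
      (Eventually.of_forall fun k => hv' (φ k)) hx hy huφ hvφ
    refine le_of_tendsto_of_tendsto' (l0.pow 2) ((((l1.pow 2).const_mul (1 - w)).add
      ((l2.pow 2).const_mul w)).sub ((l3.pow 2).const_mul (w * (1 - w)))) fun k => ?_
    exact hCAT.sq_le hb hr hs hδ hα hcone (hu _) (hv _) hc (hG _) hw
  have hK : ∀ c ∈ closure D, intrinsicDist D c p ^ 2 ≤ (1 - w) * intrinsicDist D c x ^ 2 +
      w * intrinsicDist D c y ^ 2 - w * (1 - w) * intrinsicDist D x y ^ 2 := by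
    intro c hc
    obtain ⟨z, hz, hzc⟩ := mem_closure_iff_seq_limit.1 hc
    have hz' : ∀ᶠ k in atTop, z k ∈ closure D := Eventually.of_forall fun k => subset_closure (hz k)
    have l : ∀ q ∈ closure D, Tendsto (fun k => intrinsicDist D (z k) q) atTop
        (𝓝 (intrinsicDist D c q)) := fun q hq =>
      hd.tendsto hz' (Eventually.of_forall fun _ => hq) hc hq hzc tendsto_const_nhds
    exact le_of_tendsto_of_tendsto' ((l p hp).pow 2) (((((l x hx).pow 2).const_mul (1 - w)).add
      (((l y hy).pow 2).const_mul w)).sub tendsto_const_nhds) fun k => hD _ (hz k)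
  rw [hd.geodesic_eq hx hy hp hw hK hΓ]
  exact hK c hc

end Comparison

namespace IsBruhatTitsMetric

variable {E : Type*} [NormedAddCommGroup E] {K : Set E} {d : E → E → ℝ} {C h₀ : ℝ}

theorem geodesic_unique (hB : IsBruhatTitsMetric K d) (hd : IsNearEuclideanMetric K d C h₀)
    {x y : E} (hx : x ∈ K) (hy : y ∈ K) {Γ Γ' : ℝ → E} (hΓ : IsMetricGeodesic K d x y Γ)
    (hΓ' : IsMetricGeodesic K d x y Γ') {s : ℝ} (hs : s ∈ Icc 0 (d x y)) : Γ s = Γ' s := by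
  rcases (hd.nonneg hx hy).eq_or_lt with h0 | h0
  · have : s = 0 := le_antisymm (h0 ▸ hs.2) hs.1
    rw [this, hΓ.source, hΓ'.source]
  · have hw : s / d x y ∈ Icc (0 : ℝ) 1 := ⟨div_nonneg hs.1 h0.le, (div_le_one h0).2 hs.2⟩
    have he : s / d x y * d x y = s := div_mul_cancel₀ _ h0.ne'
    have := hd.geodesic_eq hx hy (p := Γ' (s / d x y * d x y)) (by rw [he]; exact hΓ'.mapsTo hs) hw
      (fun c hc => hB.sq_le x hx y hy c hc Γ' hΓ' _ hw) hΓ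
    rwa [he] at this

/-- Two sides of a triangle, issuing from the same vertex. -/
theorem dist_le_of_common_source (hB : IsBruhatTitsMetric K d)
    (hd : IsNearEuclideanMetric K d C h₀) {x y y' : E} (hx : x ∈ K) (hy : y ∈ K) (hy' : y' ∈ K)
    {Γ Γ' : ℝ → E} (hΓ : IsMetricGeodesic K d x y Γ) (hΓ' : IsMetricGeodesic K d x y' Γ') {w : ℝ}
    (hw : w ∈ Icc (0 : ℝ) 1) : d (Γ (w * d x y)) (Γ' (w * d x y')) ≤ w * d y y' := by
  have hm : ∀ L, 0 ≤ L → w * L ∈ Icc 0 L := fun L hL =>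
    ⟨mul_nonneg hw.1 hL, mul_le_of_le_one_left hL hw.2⟩
  have hL := hd.nonneg hx hy
  have hL' := hd.nonneg hx hy'
  have hp := hΓ.mapsTo (hm _ hL)
  have hq := hΓ'.mapsTo (hm _ hL')
  have h1 := hB.sq_le x hx y hy _ hq Γ hΓ w hw
  have h2 := hB.sq_le x hx y' hy' y hy Γ' hΓ' w hw
  have h3 := hΓ'.dist_eq 0 ⟨le_rfl, hL'⟩ _ (hm _ hL') (hm _ hL').1
  rw [hΓ'.source, hd.comm _ hx _ hq, sub_zero] at h3
  rw [h3, hd.comm _ hq _ hy, hd.comm _ hq _ hp] at h1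
  rw [hd.comm _ hy _ hx] at h2
  refine abs_le_of_sq_le_sq' ?_ (mul_nonneg hw.1 (hd.nonneg hy hy')) |>.2
  have h4 := mul_le_mul_of_nonneg_left h2 hw.1
  nlinarith

theorem _root_.IsMetricGeodesic.reverse (hd : IsNearEuclideanMetric K d C h₀) {x y : E}
    (hx : x ∈ K) (hy : y ∈ K) {Γ : ℝ → E} (hΓ : IsMetricGeodesic K d x y Γ) :
    IsMetricGeodesic K d y x fun t => Γ (d x y - t) := by
  have hc := hd.comm x hx y hy
  have hm : ∀ t ∈ Icc 0 (d y x), d x y - t ∈ Icc 0 (d x y) := fun t ht => by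
    constructor <;> linarith [ht.1, ht.2]
  refine ⟨fun t ht => hΓ.mapsTo (hm t ht), by simpa using hΓ.target, ?_, ?_⟩
  · simpa [← hc] using hΓ.source
  · intro s hs t ht hst
    rw [hd.comm _ (hΓ.mapsTo (hm s hs)) _ (hΓ.mapsTo (hm t ht)),
      hΓ.dist_eq _ (hm t ht) _ (hm s hs) (by linarith)]
    ring

/-- Convexity of the metric along two geodesics. -/
theorem dist_le (hB : IsBruhatTitsMetric K d) (hd : IsNearEuclideanMetric K d C h₀)
    {x y x' y' : E} (hx : x ∈ K) (hy : y ∈ K) (hx' : x' ∈ K) (hy' : y' ∈ K) {Γ Γ' : ℝ → E}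
    (hΓ : IsMetricGeodesic K d x y Γ) (hΓ' : IsMetricGeodesic K d x' y' Γ') {w : ℝ}
    (hw : w ∈ Icc (0 : ℝ) 1) :
    d (Γ (w * d x y)) (Γ' (w * d x' y')) ≤ (1 - w) * d x x' + w * d y y' := by
  have hm : ∀ L, 0 ≤ L → w * L ∈ Icc 0 L := fun L hL =>
    ⟨mul_nonneg hw.1 hL, mul_le_of_le_one_left hL hw.2⟩
  -- the diagonal from `x` to `y'` divides the quadrangle into two triangles
  obtain ⟨G, hG⟩ := hB.exists_geodesic x hx y' hy'
  have h1 := hB.dist_le_of_common_source hd hx hy hy' hΓ hG hw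
  have h2 := hB.dist_le_of_common_source hd hy' hx hx' (hG.reverse hd hx hy')
    (hΓ'.reverse hd hx' hy') (w := 1 - w) ⟨by linarith [hw.2], by linarith [hw.1]⟩
  rw [hd.comm y' hy' x hx, hd.comm y' hy' x' hx'] at h2
  have e : ∀ L : ℝ, L - (1 - w) * L = w * L := fun L => by ring
  simp only [e] at h2
  have h3 := hd.triangle _ (hΓ.mapsTo (hm _ (hd.nonneg hx hy))) _
    (hG.mapsTo (hm _ (hd.nonneg hx hy'))) _ (hΓ'.mapsTo (hm _ (hd.nonneg hx' hy')))
  linarith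

/-- Points at the same distance `s` from the sources of two geodesics. -/
theorem dist_le_of_arclength (hB : IsBruhatTitsMetric K d) (hd : IsNearEuclideanMetric K d C h₀)
    {x y x' y' : E} (hx : x ∈ K) (hy : y ∈ K) (hx' : x' ∈ K) (hy' : y' ∈ K) {Γ Γ' : ℝ → E}
    (hΓ : IsMetricGeodesic K d x y Γ) (hΓ' : IsMetricGeodesic K d x' y' Γ') {s : ℝ}
    (hs : 0 < s) (hsL : s ≤ d x y) (hsL' : s ≤ d x' y') :
    d (Γ s) (Γ' s) ≤ 2 * (d x x' + d y y') := by
  have hL : 0 < d x y := hs.trans_le hsL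
  set w := s / d x y with hwdef
  have hw : w ∈ Icc (0 : ℝ) 1 := ⟨div_nonneg hs.le hL.le, (div_le_one hL).2 hsL⟩
  have he : w * d x y = s := div_mul_cancel₀ _ hL.ne'
  have hL' := hd.nonneg hx' hy'
  have hm : w * d x' y' ∈ Icc 0 (d x' y') := ⟨mul_nonneg hw.1 hL', mul_le_of_le_one_left hL' hw.2⟩
  have hms : s ∈ Icc 0 (d x' y') := ⟨hs.le, hsL'⟩
  have h1 := hB.dist_le hd hx hy hx' hy' hΓ hΓ' hw
  rw [he] at h1
  have hxx := hd.nonneg hx hx'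
  have hyy := hd.nonneg hy hy'
  have h2 : (1 - w) * d x x' ≤ d x x' := mul_le_of_le_one_left hxx (by linarith [hw.1])
  have h3 : w * d y y' ≤ d y y' := mul_le_of_le_one_left hyy hw.2
  have h4 : d (Γ' (w * d x' y')) (Γ' s) ≤ d x x' + d y y' := by
    have habs := hd.abs_sub_le hx hy hx' hy'
    have hle : |w * d x' y' - s| ≤ d x x' + d y y' := by
      rw [← he, ← mul_sub, abs_mul, abs_of_nonneg hw.1, abs_sub_comm]
      exact (mul_le_of_le_one_left (abs_nonneg _) hw.2).trans habs
    rcases le_total (w * d x' y') s with h | h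
    · rw [hΓ'.dist_eq _ hm _ hms h]
      linarith [neg_abs_le (w * d x' y' - s)]
    · rw [hd.comm _ (hΓ'.mapsTo hm) _ (hΓ'.mapsTo hms), hΓ'.dist_eq _ hms _ hm h]
      linarith [le_abs_self (w * d x' y' - s)]
  have h5 := hd.triangle _ (hΓ.mapsTo ⟨hs.le, hsL⟩) _ (hΓ'.mapsTo hm) _ (hΓ'.mapsTo hms)
  linarith

end IsBruhatTitsMetric

/-! ### Initial velocities and the first variation of the distance -/

section Direction

variable {E : Type*} [NormedAddCommGroup E] [InnerProductSpace ℝ E] {K : Set E} {d : E → E → ℝ}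
  {C h₀ : ℝ}

/-- The slopes of a geodesic at two comparable times differ by little, since a broken line with
sides `s` and `t - s` has a chord of length at least `t - C t ^ 3`. -/
theorem norm_slope_sub_le {a b : E} {C s t : ℝ} (hC : 0 ≤ C) (hs : 0 < s) (hst : s ≤ t)
    (hts : t ≤ 2 * s) (ha : ‖a‖ ≤ s) (hab : ‖b - a‖ ≤ t - s) (hb : ‖b‖ ≤ t)
    (hb' : t - C * t ^ 3 ≤ ‖b‖) : ‖s⁻¹ • a - t⁻¹ • b‖ ≤ √(2 * C) * t := by
  have ht : 0 < t := hs.trans_le hst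
  have hsq : t ^ 2 - ‖b‖ ^ 2 ≤ 2 * C * t ^ 4 := by
    have h1 : (t - ‖b‖) * (t + ‖b‖) ≤ C * t ^ 3 * (2 * t) :=
      mul_le_mul (by linarith) (by linarith) (by positivity) (by positivity)
    nlinarith
  have hid : ‖t • a - s • b‖ ^ 2 =
      t * (t - s) * ‖a‖ ^ 2 + t * s * ‖b - a‖ ^ 2 - s * (t - s) * ‖b‖ ^ 2 := by
    rw [norm_sub_sq_real, norm_sub_sq_real, norm_smul, norm_smul, mul_pow, mul_pow,
      inner_smul_left, inner_smul_right, Real.norm_eq_abs, Real.norm_eq_abs, sq_abs, sq_abs,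
      real_inner_comm a b]
    simp only [conj_trivial]
    ring
  have h1 : t * (t - s) * ‖a‖ ^ 2 ≤ t * (t - s) * s ^ 2 := by
    have : 0 ≤ t - s := by linarith
    gcongr
  have h2 : t * s * ‖b - a‖ ^ 2 ≤ t * s * (t - s) ^ 2 := by gcongr
  have h3 : s * (t - s) * (t ^ 2 - ‖b‖ ^ 2) ≤ s * s * (2 * C * t ^ 4) := by
    have h4 : 0 ≤ t ^ 2 - ‖b‖ ^ 2 := by nlinarith [norm_nonneg b]
    exact mul_le_mul (by nlinarith) hsq h4 (by positivity)
  have hmain : ‖t • a - s • b‖ ^ 2 ≤ s * s * (2 * C * t ^ 4) := by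
    rw [hid]
    nlinarith
  have e : s⁻¹ • a - t⁻¹ • b = (s * t)⁻¹ • (t • a - s • b) := by
    rw [smul_sub, smul_smul, smul_smul]
    congr 2 <;> field_simp
  rw [e, norm_smul, norm_inv, Real.norm_of_nonneg (by positivity), inv_mul_le_iff₀ (by positivity)]
  refine abs_le_of_sq_le_sq' ?_ (by positivity) |>.2
  rw [mul_pow, mul_pow (√(2 * C)), Real.sq_sqrt (by positivity)]
  linarith

/-- A geodesic has an initial velocity, and stays within a parabola about its tangent. -/
theorem IsNearEuclideanMetric.exists_velocity [CompleteSpace E]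
    (hd : IsNearEuclideanMetric K d C h₀) {x y : E} (hL : 0 < d x y) {Γ : ℝ → E}
    (hΓ : IsMetricGeodesic K d x y Γ) :
    ∃ v : E, ‖v‖ = 1 ∧ ∀ t, 0 ≤ t → t ≤ d x y → t ≤ h₀ →
      ‖Γ t - x - t • v‖ ≤ 2 * √(2 * C) * t ^ 2 := by
  set A := √(2 * C) with hA
  have hA0 : 0 ≤ A := Real.sqrt_nonneg _
  have z0 : (0 : ℝ) ∈ Icc 0 (d x y) := ⟨le_rfl, hL.le⟩
  set q : ℝ → E := fun t => t⁻¹ • (Γ t - x) with hq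
  have hup : ∀ t, 0 ≤ t → t ≤ d x y → ‖Γ t - x‖ ≤ t := fun t h0 h1 => by
    have := hd.norm_le_of_geodesic hΓ z0 ⟨h0, h1⟩ h0
    rwa [hΓ.source, norm_sub_rev, sub_zero] at this
  have hlow : ∀ t, 0 ≤ t → t ≤ d x y → t ≤ h₀ → t - C * t ^ 3 ≤ ‖Γ t - x‖ := fun t h0 h1 h2 => by
    have := hd.le_norm_of_geodesic hΓ z0 ⟨h0, h1⟩ h0 (by linarith)
    rwa [hΓ.source, norm_sub_rev, sub_zero] at this
  have hstep : ∀ s t, 0 < s → s ≤ t → t ≤ 2 * s → t ≤ d x y → t ≤ h₀ → ‖q s - q t‖ ≤ A * t := by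
    intro s t hs hst hts htL hth
    have ht := hs.trans_le hst
    refine norm_slope_sub_le hd.C_nonneg hs hst hts (hup s hs.le (hst.trans htL)) ?_
      (hup t ht.le htL) (hlow t ht.le htL hth)
    rw [sub_sub_sub_cancel_right, norm_sub_rev]
    exact hd.norm_le_of_geodesic hΓ ⟨hs.le, hst.trans htL⟩ ⟨ht.le, htL⟩ hst
  have hdyadic : ∀ (k : ℕ) (s t : ℝ), 0 < s → s ≤ t → t ≤ 2 ^ k * s → t ≤ d x y → t ≤ h₀ →
      ‖q s - q t‖ ≤ 2 * A * t := by
    intro k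
    induction k with
    | zero =>
      intro s t hs hst hts _ _
      have : s = t := le_antisymm hst (by simpa using hts)
      subst this
      rw [sub_self, norm_zero]
      positivity
    | succ k ih =>
      intro s t hs hst hts htL hth
      have ht := hs.trans_le hst
      rcases le_total t (2 * s) with h | h
      · refine (hstep s t hs hst h htL hth).trans ?_
        nlinarith
      · have h1 := ih s (t / 2) hs (by linarith) (by rw [pow_succ] at hts; linarith)
          (by linarith) (by linarith)
        have h2 := hstep (t / 2) t (by linarith) (by linarith) (by linarith) htL hth
        have h3 := norm_sub_le_norm_sub_add_norm_sub (q s) (q (t / 2)) (q t)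
        linarith
  have hall : ∀ s t, 0 < s → s ≤ t → t ≤ d x y → t ≤ h₀ → ‖q s - q t‖ ≤ 2 * A * t := by
    intro s t hs hst
    obtain ⟨k, hk⟩ := pow_unbounded_of_one_lt (t / s) (one_lt_two (α := ℝ))
    exact hdyadic k s t hs hst ((div_lt_iff₀ hs).1 hk).le
  have hT : 0 < min (d x y) h₀ := lt_min hL hd.h₀_pos
  have hcauchy : Cauchy (map q (𝓝[>] 0)) := by
    rw [Metric.cauchy_iff]
    refine ⟨inferInstance, fun ε hε => ?_⟩
    set τ := min (min (d x y) h₀) (ε / (2 * A + 1)) with hτ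
    have hτ0 : 0 < τ := lt_min hT (by positivity)
    have hτε : 2 * A * τ < ε := by
      have h1 : τ * (2 * A + 1) ≤ ε := (le_div_iff₀ (by positivity)).1 (min_le_right _ _)
      linarith
    have hτL : τ ≤ d x y := (min_le_left _ _).trans (min_le_left _ _)
    have hτh : τ ≤ h₀ := (min_le_left _ _).trans (min_le_right _ _)
    refine ⟨_, image_mem_map (Ioo_mem_nhdsGT hτ0), ?_⟩
    have key : ∀ s t, 0 < s → s ≤ t → t < τ → ‖q s - q t‖ < ε := fun s t hs hst ht =>
      (hall s t hs hst (ht.le.trans hτL) (ht.le.trans hτh)).trans_lt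
        (lt_of_le_of_lt (mul_le_mul_of_nonneg_left ht.le (by positivity)) hτε)
    rintro _ ⟨s, hs, rfl⟩ _ ⟨t, ht, rfl⟩
    rw [dist_eq_norm]
    rcases le_total s t with h | h
    · exact key s t hs.1 h ht.2
    · rw [norm_sub_rev]
      exact key t s ht.1 h hs.2
  obtain ⟨v, hv⟩ := cauchy_map_iff_exists_tendsto.1 hcauchy
  have hbound : ∀ t, 0 < t → t ≤ d x y → t ≤ h₀ → ‖v - q t‖ ≤ 2 * A * t := by
    intro t ht htL hth
    refine le_of_tendsto (hv.sub_const (q t)).norm ?_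
    filter_upwards [Ioo_mem_nhdsGT ht] with s hs
    exact hall s t hs.1 hs.2.le htL hth
  refine ⟨v, ?_, ?_⟩
  · have hqn : ∀ t, 0 < t → ‖q t‖ = t⁻¹ * ‖Γ t - x‖ := fun t ht => by
      rw [hq, norm_smul, norm_inv, Real.norm_of_nonneg ht.le]
    have hev := Ioo_mem_nhdsGT hT
    refine le_antisymm (le_of_tendsto hv.norm ?_) ?_
    · filter_upwards [hev] with t ht
      rw [hqn t ht.1, inv_mul_le_iff₀ ht.1, mul_one]
      exact hup t ht.1.le (ht.2.le.trans (min_le_left _ _))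
    · have hlim : Tendsto (fun t : ℝ => 1 - C * t ^ 2) (𝓝[>] 0) (𝓝 1) := by
        have hc : Continuous fun t : ℝ => 1 - C * t ^ 2 := by fun_prop
        simpa using (hc.tendsto 0).mono_left (nhdsWithin_le_nhds (s := Ioi 0))
      refine le_of_tendsto_of_tendsto hlim hv.norm ?_
      filter_upwards [hev] with t ht
      rw [hqn t ht.1, inv_mul_eq_div, le_div_iff₀ ht.1]
      have := hlow t ht.1.le (ht.2.le.trans (min_le_left _ _)) (ht.2.le.trans (min_le_right _ _))
      linarith
  · intro t ht htL hth
    rcases ht.eq_or_lt with h0 | h0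
    · rw [← h0, hΓ.source]
      simp
    · have e : Γ t - x - t • v = -(t • (v - q t)) := by
        rw [hq, smul_sub, smul_smul, mul_inv_cancel₀ h0.ne', one_smul]
        abel
      rw [e, norm_neg, norm_smul, Real.norm_of_nonneg ht]
      have := mul_le_mul_of_nonneg_left (hbound t h0 htL hth) ht
      linarith

/-- `χ x y` is the unit initial velocity of the geodesics from `x` to `y`, with a uniform bound
for their distance from the tangent. -/
structure IsDirectionField (K : Set E) (d : E → E → ℝ) (B h₀ : ℝ) (χ : E → E → E) : Prop where
  norm_eq : ∀ x ∈ K, ∀ y ∈ K, x ≠ y → ‖χ x y‖ = 1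
  norm_le : ∀ x ∈ K, ∀ y ∈ K, x ≠ y → ∀ Γ, IsMetricGeodesic K d x y Γ →
    ∀ t, 0 ≤ t → t ≤ d x y → t ≤ h₀ → ‖Γ t - x - t • χ x y‖ ≤ B * t ^ 2

variable {B : ℝ} {χ : E → E → E}

/-- The upper bound of the first variation formula: go from `u` to the point of the geodesic at
distance `σ = √‖u - x‖` from `x`, then follow the geodesic to `y`. -/
theorem IsDirectionField.dist_le (hχ : IsDirectionField K d B h₀ χ)
    (hd : IsNearEuclideanMetric K d C h₀) (hB : 0 ≤ B)
    (hgeo : ∀ x ∈ K, ∀ y ∈ K, ∃ Γ, IsMetricGeodesic K d x y Γ) {x y u : E} (hx : x ∈ K)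
    (hy : y ∈ K) (hu : u ∈ K) (hxy : x ≠ y) {σ : ℝ} (hσ : 0 ≤ σ) (hux : ‖u - x‖ = σ ^ 2)
    (hσ1 : σ ≤ 1 / 2) (hσL : σ ≤ d x y) (hσh : 2 * σ ≤ h₀) :
    d u y ≤ d x y - inner ℝ (χ x y) (u - x) + (1 + 2 * B + 8 * C) * σ ^ 3 := by
  obtain ⟨Γ, hΓ⟩ := hgeo x hx y hy
  have hL : 0 ≤ d x y := hσ.trans hσL
  have z0 : (0 : ℝ) ∈ Icc 0 (d x y) := ⟨le_rfl, hL⟩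
  have hm : σ ∈ Icc 0 (d x y) := ⟨hσ, hσL⟩
  have h1 := hχ.norm_le x hx y hy hxy Γ hΓ σ hσ hσL (by linarith)
  have h2 := hd.norm_le_of_geodesic hΓ z0 hm hσ
  rw [hΓ.source, norm_sub_rev, sub_zero] at h2
  have h3 := hΓ.dist_eq σ hm _ ⟨hL, le_rfl⟩ hσL
  rw [hΓ.target] at h3
  have htri := hd.triangle u hu _ (hΓ.mapsTo hm) y hy
  set a := u - x with ha
  set c := Γ σ - x with hc
  have eac : u - Γ σ = a - c := by rw [ha, hc]; abel
  have hac2 : ‖a - c‖ ≤ 2 * σ := by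
    refine (norm_sub_le _ _).trans ?_
    rw [hux]
    nlinarith
  have hcube := hd.le_add_cube u hu _ (hΓ.mapsTo hm) (by rw [eac]; linarith)
  rw [eac] at hcube
  have h4 : C * ‖a - c‖ ^ 3 ≤ C * (2 * σ) ^ 3 := by
    have := hd.C_nonneg
    gcongr
  have hin : |inner ℝ (χ x y) a| ≤ σ ^ 2 := by
    have := abs_real_inner_le_norm (χ x y) a
    rwa [hχ.norm_eq x hx y hy hxy, hux, one_mul] at this
  have hin2 : σ * inner ℝ (χ x y) a - B * σ ^ 4 ≤ inner ℝ a c := by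
    have e : c = (c - σ • χ x y) + σ • χ x y := by abel
    rw [e, inner_add_right, inner_smul_right, real_inner_comm (χ x y) a]
    have h5 := (abs_le.1 (abs_real_inner_le_norm a (c - σ • χ x y))).1
    have h6 : ‖a‖ * ‖c - σ • χ x y‖ ≤ σ ^ 2 * (B * σ ^ 2) := by
      rw [hux]
      gcongr
    nlinarith
  have hchord : ‖a - c‖ ≤ σ - inner ℝ (χ x y) a + (1 + 2 * B) * σ ^ 3 := by
    have hp := abs_le.1 hin
    set p := inner ℝ (χ x y) a
    have hσ2 : σ ^ 2 ≤ σ / 2 := by nlinarith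
    have h7 : 0 ≤ σ - p := by linarith
    refine abs_le_of_sq_le_sq' ?_ (add_nonneg h7 (by positivity)) |>.2
    rw [norm_sub_sq_real, hux]
    have h8 : ‖c‖ ^ 2 ≤ σ ^ 2 := by gcongr
    have h9 : (1 + 2 * B) * σ ^ 3 * (σ / 2) ≤ (1 + 2 * B) * σ ^ 3 * (σ - p) :=
      mul_le_mul_of_nonneg_left (by linarith) (by positivity)
    have h10 : (σ - p + (1 + 2 * B) * σ ^ 3) ^ 2 = (σ - p) ^ 2 +
        2 * ((1 + 2 * B) * σ ^ 3 * (σ - p)) + ((1 + 2 * B) * σ ^ 3) ^ 2 := by ring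
    rw [h10]
    nlinarith [sq_nonneg p, sq_nonneg ((1 + 2 * B) * σ ^ 3)]
  have e8 : C * (2 * σ) ^ 3 = 8 * C * σ ^ 3 := by ring
  linarith

/-- The direction field is Hölder continuous with exponent `1 / 2` away from the diagonal: by
convexity of the metric, geodesics with end points at distance at most `σ ^ 2` are at distance
`O(σ ^ 2)` at time `σ`. -/
theorem IsDirectionField.exists_norm_sub_le (hχ : IsDirectionField K d B h₀ χ)
    (hd : IsNearEuclideanMetric K d C h₀) (hB : 0 ≤ B) (hBT : IsBruhatTitsMetric K d) {c₁ : ℝ}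
    (hc₁ : 0 < c₁) :
    ∃ σ₀ M : ℝ, 0 < σ₀ ∧ 0 ≤ M ∧ ∀ x ∈ K, ∀ y ∈ K, ∀ x' ∈ K, ∀ y' ∈ K, c₁ ≤ d x y → c₁ ≤ d x' y' →
      ∀ σ, 0 ≤ σ → σ ≤ σ₀ → ‖x - x'‖ + ‖y - y'‖ ≤ σ ^ 2 → ‖χ x y - χ x' y'‖ ≤ M * σ := by
  have hC := hd.C_nonneg
  refine ⟨min c₁ (min h₀ 1), 2 * (1 + C * h₀ ^ 2) + 1 + 2 * B,
    lt_min hc₁ (lt_min hd.h₀_pos one_pos), by positivity, ?_⟩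
  intro x hx y hy x' hx' y' hy' hL hL' σ hσ hσ₀ hdist
  have hσc : σ ≤ c₁ := hσ₀.trans (min_le_left _ _)
  have hσh : σ ≤ h₀ := hσ₀.trans ((min_le_right _ _).trans (min_le_left _ _))
  have hσ1 : σ ≤ 1 := hσ₀.trans ((min_le_right _ _).trans (min_le_right _ _))
  have nx := norm_nonneg (x - x')
  have ny := norm_nonneg (y - y')
  rcases hσ.eq_or_lt with h0 | h0
  · have e : (0 : ℝ) ^ 2 = 0 := by norm_num
    rw [← h0, e] at hdist
    have e1 : x = x' := sub_eq_zero.1 (norm_le_zero_iff.1 (by linarith))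
    have e2 : y = y' := sub_eq_zero.1 (norm_le_zero_iff.1 (by linarith))
    rw [e1, e2, ← h0]
    simp
  have hne : ∀ a ∈ K, ∀ b ∈ K, c₁ ≤ d a b → a ≠ b := by
    rintro a ha b hb h rfl
    rw [hd.self ha] at h
    linarith
  obtain ⟨Γ, hΓ⟩ := hBT.exists_geodesic x hx y hy
  obtain ⟨Γ', hΓ'⟩ := hBT.exists_geodesic x' hx' y' hy'
  have h1 := hχ.norm_le x hx y hy (hne x hx y hy hL) Γ hΓ σ hσ (hσc.trans hL) hσh
  have h2 := hχ.norm_le x' hx' y' hy' (hne x' hx' y' hy' hL') Γ' hΓ' σ hσ (hσc.trans hL') hσh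
  have h3 := hBT.dist_le_of_arclength hd hx hy hx' hy' hΓ hΓ' h0 (hσc.trans hL) (hσc.trans hL')
  have h4 := hd.norm_le _ (hΓ.mapsTo ⟨hσ, hσc.trans hL⟩) _ (hΓ'.mapsTo ⟨hσ, hσc.trans hL'⟩)
  have hσσ : σ ^ 2 ≤ h₀ := by nlinarith
  have h5 := hd.le_mul hx hx' (by linarith)
  have h6 := hd.le_mul hy hy' (by linarith)
  have h7 : (1 + C * h₀ ^ 2) * (‖x - x'‖ + ‖y - y'‖) ≤ (1 + C * h₀ ^ 2) * σ ^ 2 := by gcongr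
  have e : σ • (χ x y - χ x' y') =
      (Γ σ - Γ' σ) - (x - x') - (Γ σ - x - σ • χ x y) + (Γ' σ - x' - σ • χ x' y') := by
    rw [smul_sub]; abel
  have h8 : σ * ‖χ x y - χ x' y'‖ ≤ σ * ((2 * (1 + C * h₀ ^ 2) + 1 + 2 * B) * σ) := by
    rw [← Real.norm_of_nonneg hσ, ← norm_smul, Real.norm_of_nonneg hσ, e]
    refine (norm_add_le _ _).trans ?_
    have h9 := norm_sub_le (Γ σ - Γ' σ - (x - x')) (Γ σ - x - σ • χ x y)
    have h10 := norm_sub_le (Γ σ - Γ' σ) (x - x')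
    nlinarith
  exact le_of_mul_le_mul_left h8 h0

/-- The first variation formula. The lower bound is the upper bound with `u` and `x` interchanged,
since `χ u y` is close to `χ x y`. -/
theorem IsDirectionField.exists_abs_dist_sub_le (hχ : IsDirectionField K d B h₀ χ)
    (hd : IsNearEuclideanMetric K d C h₀) (hB : 0 ≤ B) (hBT : IsBruhatTitsMetric K d) {c₁ : ℝ}
    (hc₁ : 0 < c₁) :
    ∃ c₂ c₃ : ℝ, 0 < c₂ ∧ 0 ≤ c₃ ∧ ∀ x ∈ K, ∀ y ∈ K, ∀ u ∈ K, c₁ ≤ d x y → √‖u - x‖ ≤ c₂ →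
      |d u y - (d x y - inner ℝ (χ x y) (u - x))| ≤ c₃ * √‖u - x‖ ^ 3 := by
  obtain ⟨σ₀, M, hσ₀, hM, hcont⟩ := hχ.exists_norm_sub_le hd hB hBT (half_pos hc₁)
  have hC := hd.C_nonneg
  have hh := hd.h₀_pos
  have hκ : 0 < 1 + C * h₀ ^ 2 := by positivity
  refine ⟨min (min (1 / 2) (c₁ / 2)) (min (min (h₀ / 2) σ₀) (c₁ / (1 + C * h₀ ^ 2))),
    (1 + 2 * B + 8 * C) + M, by positivity, by positivity, ?_⟩
  intro x hx y hy u hu hL hle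
  set σ := √‖u - x‖ with hσdef
  have hσ : 0 ≤ σ := Real.sqrt_nonneg _
  have hux : ‖u - x‖ = σ ^ 2 := (Real.sq_sqrt (norm_nonneg _)).symm
  simp only [le_min_iff] at hle
  obtain ⟨⟨hσ1, hσc⟩, ⟨hσh, hσσ₀⟩, hσκ⟩ := hle
  rw [le_div_iff₀ hκ] at hσκ
  have hxu : ‖x - u‖ = σ ^ 2 := by rw [norm_sub_rev, hux]
  have hdxu := hd.le_mul hx hu (by rw [hxu]; nlinarith)
  rw [hxu] at hdxu
  have hdxu2 : d x u ≤ c₁ / 2 := by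
    refine hdxu.trans ?_
    have : σ * (σ * (1 + C * h₀ ^ 2)) ≤ 1 / 2 * c₁ :=
      mul_le_mul hσ1 hσκ (by positivity) (by norm_num)
    linarith
  have htri := hd.triangle x hx u hu y hy
  have hLu : c₁ / 2 ≤ d u y := by linarith
  have hne : ∀ a ∈ K, ∀ b ∈ K, 0 < d a b → a ≠ b := by
    rintro a ha b hb h rfl
    rw [hd.self ha] at h
    exact lt_irrefl _ h
  have h1 := hχ.dist_le hd hB hBT.exists_geodesic hx hy hu (hne x hx y hy (by linarith)) hσ hux
    hσ1 (by linarith) (by linarith)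
  have h2 := hχ.dist_le hd hB hBT.exists_geodesic hu hy hx (hne u hu y hy (by linarith)) hσ hxu
    hσ1 (by linarith) (by linarith)
  have h3 := hcont x hx y hy u hu y hy (by linarith) hLu σ hσ hσσ₀ (by rw [hxu]; simp)
  have h4 := real_inner_le_norm (χ x y - χ u y) (x - u)
  have h5 : ‖χ x y - χ u y‖ * ‖x - u‖ ≤ M * σ * σ ^ 2 := by
    rw [hxu]
    gcongr
  rw [inner_sub_left] at h4
  have e : inner ℝ (χ x y) (u - x) = -inner ℝ (χ x y) (x - u) := by
    rw [← inner_neg_right, neg_sub]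
  have hMσ : 0 ≤ M * σ ^ 3 := by positivity
  have e3 : (1 + 2 * B + 8 * C + M) * σ ^ 3 = (1 + 2 * B + 8 * C) * σ ^ 3 + M * σ ^ 3 := by ring
  have e4 : M * σ * σ ^ 2 = M * σ ^ 3 := by ring
  rw [abs_le, e3]
  constructor <;> linarith

end Direction

/-! ### Gradients of the distance -/

section Gradient

variable {n : ℕ} {D : Set (EuclideanSpace ℝ (Fin n))} {C h₀ : ℝ}

theorem hasDerivWithinAt_of_norm_le {E : Type*} [NormedAddCommGroup E] [NormedSpace ℝ E]
    {Γ : ℝ → E} {v : E} {B h₀ L : ℝ} (hh : 0 < h₀)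
    (h : ∀ t, 0 ≤ t → t ≤ L → t ≤ h₀ → ‖Γ t - Γ 0 - t • v‖ ≤ B * t ^ 2) :
    HasDerivWithinAt Γ v (Icc 0 L) 0 := by
  rw [hasDerivWithinAt_iff_isLittleO]
  refine Asymptotics.IsBigO.trans_isLittleO (g := fun t : ℝ => (t - 0) ^ 2) ?_ ?_
  · refine Asymptotics.IsBigO.of_bound B ?_
    filter_upwards [self_mem_nhdsWithin, mem_nhdsWithin_of_mem_nhds (Iio_mem_nhds hh)] with t ht ht'
    rw [sub_zero, Real.norm_of_nonneg (sq_nonneg t)]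
    exact h t ht.1 ht.2 (le_of_lt ht')
  · have h1 : (fun t : ℝ => t ^ 2) =o[𝓝 0] fun t : ℝ => t := by
      simpa using Asymptotics.isLittleO_pow_pow (𝕜 := ℝ) one_lt_two
    simpa using h1.mono nhdsWithin_le_nhds

theorem IsBruhatTitsMetric.hasDerivWithinAt_and_isDirectionField
    (hBT : IsBruhatTitsMetric (closure D) (intrinsicDist D))
    (hd : IsNearEuclideanMetric (closure D) (intrinsicDist D) C h₀)
    (hiff : ∀ x ∈ closure D, ∀ y ∈ closure D, ∀ Γ, IsIntrinsicGeodesic D x y Γ ↔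
      IsMetricGeodesic (closure D) (intrinsicDist D) x y Γ) :
    (∀ x ∈ closure D, ∀ y ∈ closure D, x ≠ y → ∀ Γ, IsIntrinsicGeodesic D x y Γ →
      HasDerivWithinAt Γ (geodesicDirection D x y) (Icc 0 (intrinsicDist D x y)) 0) ∧
    IsDirectionField (closure D) (intrinsicDist D) (2 * √(2 * C)) h₀ (geodesicDirection D) := by
  have key : ∀ x ∈ closure D, ∀ y ∈ closure D, x ≠ y → ‖geodesicDirection D x y‖ = 1 ∧
      ∀ Γ, IsMetricGeodesic (closure D) (intrinsicDist D) x y Γ →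
        ∀ t, 0 ≤ t → t ≤ intrinsicDist D x y → t ≤ h₀ →
          ‖Γ t - x - t • geodesicDirection D x y‖ ≤ 2 * √(2 * C) * t ^ 2 := by
    intro x hx y hy hxy
    have hL : 0 < intrinsicDist D x y :=
      (norm_pos_iff.2 (sub_ne_zero.2 hxy)).trans_le (hd.norm_le x hx y hy)
    have hex : ∃ Γ, IsIntrinsicGeodesic D x y Γ := by
      obtain ⟨Γ, hΓ⟩ := hBT.exists_geodesic x hx y hy
      exact ⟨Γ, (hiff x hx y hy Γ).2 hΓ⟩
    have hΓ₀ := (hiff x hx y hy _).1 hex.choose_spec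
    obtain ⟨v, hv, hbound⟩ := hd.exists_velocity hL hΓ₀
    have hder : HasDerivWithinAt hex.choose v (Icc 0 (intrinsicDist D x y)) 0 :=
      hasDerivWithinAt_of_norm_le hd.h₀_pos (by rw [hΓ₀.source]; exact hbound)
    have heq : geodesicDirection D x y = v := by
      rw [geodesicDirection, dif_pos hex]
      exact hder.derivWithin (uniqueDiffOn_Icc hL 0 ⟨le_rfl, hL.le⟩)
    rw [heq]
    refine ⟨hv, fun Γ hΓ t ht htL hth => ?_⟩
    rw [hBT.geodesic_unique hd hx hy hΓ hΓ₀ ⟨ht, htL⟩]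
    exact hbound t ht htL hth
  refine ⟨fun x hx y hy hxy Γ hΓ => ?_, fun x hx y hy hxy => (key x hx y hy hxy).1,
    fun x hx y hy hxy => (key x hx y hy hxy).2⟩
  have hΓ' := (hiff x hx y hy Γ).1 hΓ
  refine hasDerivWithinAt_of_norm_le (B := 2 * √(2 * C)) hd.h₀_pos ?_
  rw [hΓ'.source]
  exact (key x hx y hy hxy).2 Γ hΓ'

variable {E : Type*} [NormedAddCommGroup E] [InnerProductSpace ℝ E] {K : Set E} {d : E → E → ℝ}
  {B : ℝ} {χ : E → E → E}

theorem sqrt_pow_three (h : ℝ) (hh : 0 ≤ h) : √h ^ 3 = h ^ (3 / 2 : ℝ) := by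
  rw [Real.sqrt_eq_rpow, ← Real.rpow_natCast, ← Real.rpow_mul hh]
  norm_num

theorem isLittleO_sqrt_pow_three {F : Type*} [NormedAddCommGroup F] (p : F) :
    (fun q => √‖q - p‖ ^ 3) =o[𝓝 p] fun q => q - p := by
  have h1 : (fun q => √‖q - p‖) =o[𝓝 p] fun _ => (1 : ℝ) := by
    rw [Asymptotics.isLittleO_one_iff]
    have hc : Continuous fun q => √‖q - p‖ := by fun_prop
    simpa using hc.tendsto p
  have h2 := h1.mul_isBigO (Asymptotics.isBigO_refl (fun q => ‖q - p‖) (𝓝 p))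
  refine Asymptotics.isLittleO_norm_right.1 (h2.congr (fun q => ?_) fun q => one_mul _)
  rw [pow_succ', Real.sq_sqrt (norm_nonneg _)]

/-- The gradient of the distance to a fixed point. -/
theorem IsDirectionField.hasGradientWithinAt [CompleteSpace E] (hχ : IsDirectionField K d B h₀ χ)
    (hd : IsNearEuclideanMetric K d C h₀) (hB : 0 ≤ B) (hBT : IsBruhatTitsMetric K d) {x y : E}
    (hx : x ∈ K) (hy : y ∈ K) (hxy : x ≠ y) :
    HasGradientWithinAt (fun u => d u y) (-χ x y) K x := by
  have hL : 0 < d x y := (norm_pos_iff.2 (sub_ne_zero.2 hxy)).trans_le (hd.norm_le x hx y hy)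
  obtain ⟨c₂, c₃, hc₂, -, h⟩ := hχ.exists_abs_dist_sub_le hd hB hBT hL
  rw [hasGradientWithinAt_iff_isLittleO]
  refine Asymptotics.IsBigO.trans_isLittleO (g := fun u => √‖u - x‖ ^ 3) ?_
    ((isLittleO_sqrt_pow_three x).mono nhdsWithin_le_nhds)
  refine Asymptotics.IsBigO.of_bound c₃ ?_
  have hc : Tendsto (fun u => √‖u - x‖) (𝓝[K] x) (𝓝 0) := by
    have hc : Continuous fun u => √‖u - x‖ := by fun_prop
    simpa using (hc.tendsto x).mono_left nhdsWithin_le_nhds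
  filter_upwards [self_mem_nhdsWithin, hc.eventually (gt_mem_nhds hc₂)] with u hu hu'
  rw [Real.norm_eq_abs, Real.norm_of_nonneg (by positivity)]
  refine le_trans (le_of_eq ?_) (h x hx y hy u hu le_rfl hu'.le)
  rw [inner_neg_left]
  congr 1
  ring

/-- The gradient of the distance as a function of both points: the first variation formula at `x`
holds uniformly for `v` near `y`, and `χ x v` tends to `χ x y`. -/
theorem IsDirectionField.hasGradientWithinAt_prod [CompleteSpace E]
    (hχ : IsDirectionField K d B h₀ χ) (hd : IsNearEuclideanMetric K d C h₀) (hB : 0 ≤ B)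
    (hBT : IsBruhatTitsMetric K d) {x y : E} (hx : x ∈ K) (hy : y ∈ K) (hxy : x ≠ y) :
    HasGradientWithinAt (fun p : WithLp 2 (E × E) => d p.fst p.snd)
      (WithLp.toLp 2 (-χ x y, -χ y x)) {p | p.fst ∈ K ∧ p.snd ∈ K} (WithLp.toLp 2 (x, y)) := by
  have hL : 0 < d x y := (norm_pos_iff.2 (sub_ne_zero.2 hxy)).trans_le (hd.norm_le x hx y hy)
  obtain ⟨c₂, c₃, hc₂, hc₃, h⟩ := hχ.exists_abs_dist_sub_le hd hB hBT (half_pos hL)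
  obtain ⟨σ₀, M, hσ₀, hM, hcont⟩ := hχ.exists_norm_sub_le hd hB hBT (half_pos hL)
  set P : WithLp 2 (E × E) := WithLp.toLp 2 (x, y) with hP
  rw [hasGradientWithinAt_iff_isLittleO]
  refine Asymptotics.IsBigO.trans_isLittleO (g := fun p => √‖p - P‖ ^ 3) ?_
    ((isLittleO_sqrt_pow_three P).mono nhdsWithin_le_nhds)
  refine Asymptotics.IsBigO.of_bound (2 * c₃ + M) ?_
  have hσ : Tendsto (fun p => √‖p - P‖) (𝓝[{p | p.fst ∈ K ∧ p.snd ∈ K}] P) (𝓝 0) := by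
    have hc : Continuous fun p => √‖p - P‖ := by fun_prop
    simpa using (hc.tendsto P).mono_left nhdsWithin_le_nhds
  have hsnd : Tendsto (fun p : WithLp 2 (E × E) => p.snd) (𝓝[{p | p.fst ∈ K ∧ p.snd ∈ K}] P)
      (𝓝 y) := by
    have hc : Continuous fun p : WithLp 2 (E × E) => p.snd := by fun_prop
    exact (hc.tendsto P).mono_left nhdsWithin_le_nhds
  have hdist : Tendsto (fun p : WithLp 2 (E × E) => d x p.snd)
      (𝓝[{p | p.fst ∈ K ∧ p.snd ∈ K}] P) (𝓝 (d x y)) :=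
    hd.tendsto (Eventually.of_forall fun _ => hx) (eventually_mem_nhdsWithin.mono fun p hp => hp.2)
      hx hy tendsto_const_nhds hsnd
  filter_upwards [self_mem_nhdsWithin, hσ.eventually (gt_mem_nhds hc₂),
    hσ.eventually (gt_mem_nhds hσ₀), hdist.eventually (lt_mem_nhds (half_lt_self hL))]
    with p hp hp1 hp2 hp3
  obtain ⟨hu, hv⟩ := hp
  set u := p.fst
  set v := p.snd
  set N := ‖p - P‖ with hN
  have hN2 : N ^ 2 = ‖u - x‖ ^ 2 + ‖v - y‖ ^ 2 := WithLp.prod_norm_sq_eq_of_L2 (p - P)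
  have hNu : ‖u - x‖ ≤ N := by
    refine abs_le_of_sq_le_sq' ?_ (norm_nonneg _) |>.2
    nlinarith [sq_nonneg ‖v - y‖]
  have hNv : ‖v - y‖ ≤ N := by
    refine abs_le_of_sq_le_sq' ?_ (norm_nonneg _) |>.2
    nlinarith [sq_nonneg ‖u - x‖]
  have hs0 : 0 ≤ √N := Real.sqrt_nonneg _
  have hsN : √N ^ 2 = N := Real.sq_sqrt (norm_nonneg _)
  have h1 := h x hx v hv u hu hp3.le ((Real.sqrt_le_sqrt hNu).trans hp1.le)
  have h2 := h y hy x hx v hv (by rw [hd.comm y hy x hx]; linarith)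
    ((Real.sqrt_le_sqrt hNv).trans hp1.le)
  have h3 := hcont x hx v hv x hx y hy hp3.le (by linarith) (√N) hs0 hp2.le
    (by rw [sub_self, norm_zero, zero_add, hsN]; exact hNv)
  have h4 := abs_real_inner_le_norm (χ x v - χ x y) (u - x)
  have h5 : ‖χ x v - χ x y‖ * ‖u - x‖ ≤ M * √N * √N ^ 2 := by
    rw [hsN]
    gcongr
  have h6 : c₃ * √‖u - x‖ ^ 3 ≤ c₃ * √N ^ 3 := by gcongr
  have h7 : c₃ * √‖v - y‖ ^ 3 ≤ c₃ * √N ^ 3 := by gcongr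
  rw [hd.comm v hv x hx, hd.comm y hy x hx] at h2
  have hinner : inner ℝ (WithLp.toLp 2 (-χ x y, -χ y x)) (p - P) =
      -inner ℝ (χ x y) (u - x) - inner ℝ (χ y x) (v - y) := by
    rw [WithLp.prod_inner_apply, ← inner_neg_left, sub_eq_add_neg (inner ℝ _ _), ← inner_neg_left]
    rfl
  rw [Real.norm_eq_abs, Real.norm_of_nonneg (by positivity), hinner]
  change |d u v - d x y - _| ≤ _
  have a1 := abs_le.1 h1
  have a2 := abs_le.1 h2
  rw [inner_sub_left] at h4
  have a4 := abs_le.1 h4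
  have e : M * √N * √N ^ 2 = M * √N ^ 3 := by ring
  rw [abs_le]
  constructor <;> linarith [a1.1, a1.2, a2.1, a2.2, a4.1, a4.2]

end Gradient

theorem proposition2p10 {n : ℕ} (hn : 2 ≤ n) (D : Set (EuclideanSpace ℝ (Fin n)))
    (hCAT : IsCAT0Domain D) (hbdd : Bornology.IsBounded D)
    (r : ℝ) (hr : 0 < r) (hsphere : UniformExteriorSphere D r)
    (δ α : ℝ) (hδ : 0 < δ) (hα : α ∈ Set.Ioc 0 (Real.pi / 2))
    (hcone : UniformInteriorCone D δ α) :
    -- the direction field `χ` is well defined: geodesics exist, and all those from `x` to `y` have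
    -- the unit vector `χ(x, y)` as initial velocity
    (∀ x ∈ closure D, ∀ y ∈ closure D, x ≠ y →
      (∃ Γ, IsIntrinsicGeodesic D x y Γ) ∧ ‖geodesicDirection D x y‖ = 1 ∧
      ∀ Γ, IsIntrinsicGeodesic D x y Γ →
        HasDerivWithinAt Γ (geodesicDirection D x y) (Set.Icc 0 (intrinsicDist D x y)) 0) ∧
    (∀ c₁ : ℝ, 0 < c₁ → ∃ c₂ c₃ : ℝ, 0 < c₂ ∧
      ∀ x ∈ closure D, ∀ y ∈ closure D, ∀ u ∈ closure D,
        c₁ ≤ intrinsicDist D x y → max (Real.sqrt ‖u - x‖) ‖u - x‖ ≤ c₂ →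
        |intrinsicDist D u y - (intrinsicDist D x y +
            ‖u - x‖ * Real.cos (InnerProductGeometry.angle (-geodesicDirection D x y) (u - x)))|
          ≤ c₃ * ‖u - x‖ ^ (3 / 2 : ℝ)) ∧
    (∀ x ∈ closure D, ∀ y ∈ closure D, x ≠ y →
      HasGradientWithinAt (fun u => intrinsicDist D u y) (-geodesicDirection D x y)
        (closure D) x) ∧
    (∀ x ∈ closure D, ∀ y ∈ closure D, x ≠ y →
      HasGradientWithinAt
        (fun p : WithLp 2 (EuclideanSpace ℝ (Fin n) × EuclideanSpace ℝ (Fin n)) =>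
          intrinsicDist D p.fst p.snd)
        (WithLp.toLp 2 (-geodesicDirection D x y, -geodesicDirection D y x))
        {p | p.fst ∈ closure D ∧ p.snd ∈ closure D} (WithLp.toLp 2 (x, y))) := by
  have hd := isNearEuclideanMetric_intrinsicDist hCAT.isOpen hCAT.isConnected hr hsphere hδ hα hcone
  have hBT := hCAT.isBruhatTitsMetric hbdd hr hsphere hδ hα hcone
  have hiff := fun x hx y hy Γ => isIntrinsicGeodesic_iff (x := x) (y := y) (Γ := Γ) hCAT.isOpen
    hCAT.isConnected hr hsphere hδ hα hcone hx hy
  obtain ⟨hder, hχ⟩ := hBT.hasDerivWithinAt_and_isDirectionField hd hiff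
  have hB : 0 ≤ 2 * √(2 * (1 / (4 * r ^ 2))) := by positivity
  refine ⟨?_, ?_, ?_, ?_⟩
  · intro x hx y hy hxy
    obtain ⟨Γ, hΓ⟩ := hBT.exists_geodesic x hx y hy
    exact ⟨⟨Γ, (hiff x hx y hy Γ).2 hΓ⟩, hχ.norm_eq x hx y hy hxy, hder x hx y hy hxy⟩
  · intro c₁ hc₁
    obtain ⟨c₂, c₃, hc₂, -, h⟩ := hχ.exists_abs_dist_sub_le hd hB hBT hc₁
    refine ⟨c₂, c₃, hc₂, fun x hx y hy u hu hL hle => ?_⟩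
    have hxy : x ≠ y := by
      rintro rfl
      rw [hd.self hx] at hL
      linarith
    have hcos := InnerProductGeometry.cos_angle_mul_norm_mul_norm (-geodesicDirection D x y) (u - x)
    rw [norm_neg, hχ.norm_eq x hx y hy hxy, one_mul, inner_neg_left, mul_comm] at hcos
    rw [hcos, ← sub_eq_add_neg, ← sqrt_pow_three _ (norm_nonneg _)]
    exact h x hx y hy u hu hL ((le_max_left _ _).trans hle)
  · exact fun x hx y hy hxy => hχ.hasGradientWithinAt hd hB hBT hx hy hxy
  · exact fun x hx y hy hxy => hχ.hasGradientWithinAt_prod hd hB hBT hx hy hxy
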